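/- **Setting.** Let $0<p_2<p_1<1$, $\gamma_1,\gamma_2>0$ with $\gamma_1+\gamma_2=1$, and let $$\frac{1}{1+(D-2)p_2}<\alpha<1,\qquad D=\frac{1}{p_1-p_2}\Big(\frac{p_1+p_2}{2}+\sqrt{2(p_1-p_2)+\tfrac{(p_1+p_2)^2}{4}}\Big).$$ Consider $N\ge 1$ users, of which $\gamma_kN$ belong to class $k\in\{1,2\}$. In each slot $t=0,1,2,\dots$ exactly $M=\alpha N$ users are scheduled ($\gamma_kN$ and $\alpha N$ are assumed to be integers). Each user has an age, a positive integer. The age of a user of class $k$ that is scheduled becomes $1$ with probability $p_k$ (successful decoding) and increases by $1$ otherwise; the age of a user that is not scheduled increases by $1$. In each slot, decoding successes are independent across users and independent of the past and of the scheduling decision. Whittle's index policy schedules $M$ users with the highest values of $W^k(i)=\frac{(i-1)p_k i}{2}+i$ ($k$ the class, $i$ the age). Ties are broken arbitrarily (possibly at random and depending on the past), with one exception: if $\alpha>\frac{\gamma_1}{1+p_1}+\frac{\gamma_2}{1+p_2}$, then among users of age $1$, where $W^1(1)=W^2(1)=1$, those of class $1$ are scheduled before those of class $2$. Let $Z_i^{k,N}(t)$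 be the number of users of class $k$ with age $i$ at time $t$ divided by $N$, let $Z^N(t)=(Z_i^{k,N}(t))_{k,i}$, let $\|v\|=\sum_{k=1}^2\sum_{i\ge1}|v_i^k|\,i$, and let $P_x$ denote the probability conditioned on $Z^N(0)=x$. **The vector $z^*$.** For an integer $n\ge 1$, let $u_k^n(i)=\frac{p_k}{np_k+1-p_k}$ for $1\le i\le n$ and $u_k^n(i)=(1-p_k)^{i-n}\frac{p_k}{np_k+1-p_k}$ for $i\ge n$ (the stationary distribution of the age of a class-$k$ user scheduled exactly when its age is at least $n$). Order the pairs (class, age) by $(k,i)\prec(m,j)$ iff $W^k(i)<W^m(j)$, or $W^k(i)=W^m(j)$, $k=2$ and $m=1$. For a pair $(m,q)$ let $l_k^1=1+\max\{i\ge1:(k,i)\preceq(m,q)\}$ and $l_k^2=1+\max\{i\ge1:(k,i)\prec(m,q)\}$, with $\max\emptyset=0$. **Lemma.** There is exactly one vector $z^*$ of the form $z_i^{k,*}=\gamma_k\big(\theta u_k^{l_k^1}(i)+(1-\theta)u_k^{l_k^2}(i)\big)$, where $l_k^1,l_k^2$ are given by some pair $(m,q)$ and where $0<\theta\le1$ satisfies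 $$\theta\sum_{k}\gamma_k\sum_{i\ge l_k^1}u_k^{l_k^1}(i)+(1-\theta)\sum_{k}\gamma_k\sum_{i\ge l_k^2}u_k^{l_k^2}(i)=\alpha .$$ For every $x$ and every $\mu>0$ there is a time $T_0$ such that for every $T>T_0$ there is a constant $s>0$, independent of $N$ (and of the way ties are broken), with $$P_x\Big(\sup_{T_0\le t<T}\|Z^N(t)-z^*\|\ge\mu\Big)\le\frac{s}{N}$$ for every such system, for every $N$ for which the conditioning event has positive probability. -/

import Mathlib

open MeasureTheory ProbabilityTheory
open scoped ENNReal

namespace WhittleAoI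

/-- Whittle's index of age `i` for a user with decoding success probability `p`. -/
noncomputable def whittleIndex (p : ℝ) (i : ℕ) : ℝ :=
  ((i : ℝ) - 1) * p * i / 2 + i

/-- The stationary distribution of the age (a positive integer) of a user with success
probability `p` that is scheduled exactly when its age is at least the threshold `n ≥ 1`. -/
noncomputable def statDist (p : ℝ) (n i : ℕ) : ℝ :=
  if i = 0 then 0
  else if i ≤ n then p / (n * p + 1 - p)
  else (1 - p) ^ (i - n) * (p / (n * p + 1 - p))

/-- `prec p k i m j`: the pair (class `k`, age `i`) has lower priority than the pair
(class `m`, age `j`). The order is that of Whittle's index; if the indices of the two classes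
coincide, class `1 : Fin 2` (the second class) ranks below class `0 : Fin 2` (the first class). -/
def prec (p : Fin 2 → ℝ) (k : Fin 2) (i : ℕ) (m : Fin 2) (j : ℕ) : Prop :=
  whittleIndex (p k) i < whittleIndex (p m) j ∨
    (whittleIndex (p k) i = whittleIndex (p m) j ∧ m < k)

/-- One plus the largest age `i ≥ 1` of class `k` that ranks strictly below (class `m`, age `q`)
(equal to `1` if there is no such age). -/
noncomputable def thresholdLow (p : Fin 2 → ℝ) (m : Fin 2) (q : ℕ) (k : Fin 2) : ℕ :=
  sSup {i : ℕ | 1 ≤ i ∧ prec p k i m q} + 1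

/-- One plus the largest age `i ≥ 1` of class `k` that ranks below (class `m`, age `q`) or is
equal to it (equal to `1` if there is no such age). -/
noncomputable def thresholdHigh (p : Fin 2 → ℝ) (m : Fin 2) (q : ℕ) (k : Fin 2) : ℕ :=
  sSup {i : ℕ | 1 ≤ i ∧ (prec p k i m q ∨ (k = m ∧ i = q))} + 1

/-- The stationary proportion of scheduled users when class `k` uses the threshold `l k`. -/
noncomputable def scheduledMass (p γ : Fin 2 → ℝ) (l : Fin 2 → ℕ) : ℝ :=
  ∑ k, γ k * ∑' j : ℕ, statDist (p k) (l k) (l k + j)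

/-- `z k i` is the proportion of users of class `k` and age `i` under the optimal policy of the
relaxed problem: a mixture, with weights `θ` and `1 - θ`, of the two threshold vectors on either
side of one pair (class `m`, age `q`), such that the proportion of scheduled users is `α`. -/
def IsRelaxedOptimum (p γ : Fin 2 → ℝ) (α : ℝ) (z : Fin 2 → ℕ → ℝ) : Prop :=
  ∃ (m : Fin 2) (q : ℕ) (θ : ℝ), 1 ≤ q ∧ 0 < θ ∧ θ ≤ 1 ∧
    θ * scheduledMass p γ (thresholdHigh p m q) +
      (1 - θ) * scheduledMass p γ (thresholdLow p m q) = α ∧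
    ∀ k i, z k i = γ k * (θ * statDist (p k) (thresholdHigh p m q k) i +
      (1 - θ) * statDist (p k) (thresholdLow p m q k) i)

/-- The weighted norm `∑ₖ ∑ᵢ |v k i| i`, with values in `[0, ∞]`. -/
noncomputable def weightedNorm (v : Fin 2 → ℕ → ℝ) : ℝ≥0∞ :=
  ∑ k, ∑' i : ℕ, ENNReal.ofReal (|v k i| * i)

/-- The constant `D` of the assumption on `α`: the positive root of `w₂(n + 1) = w₁(n)`. -/
noncomputable def alternationBound (p₁ p₂ : ℝ) : ℝ :=
  1 / (p₁ - p₂) * ((p₁ + p₂) / 2 + √(2 * (p₁ - p₂) + (p₁ + p₂) ^ 2 / 4))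

/-- The ages at time `t`, from the initial ages, the sets of scheduled users and the channel
states (`true`: no decoding error). -/
def ages {N : ℕ} (s₀ : Fin N → ℕ) (a : ℕ → Finset (Fin N)) (c : ℕ → Fin N → Bool) :
    ℕ → Fin N → ℕ
  | 0 => s₀
  | t + 1 => fun i => if i ∈ a t ∧ c t i = true then 1 else ages s₀ a c t i + 1

/-- A system of `N` users and `M` channels on the probability space `(Ω, P)`, driven by Whittle's
index policy. Users are partitioned by `cls` in two classes with success probabilities `p 0` and
`p 1`. The policy is causal with respect to the filtration `ℱ`; ties are broken arbitrarily,
possibly at random and depending on the history. -/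
structure WhittleSystem (p : Fin 2 → ℝ) (N M : ℕ) {Ω : Type*} [MeasurableSpace Ω]
    (P : Measure Ω) where
  cls : Fin N → Fin 2
  ℱ : Filtration ℕ (inferInstance : MeasurableSpace Ω)
  /-- initial ages -/
  init : Ω → Fin N → ℕ
  /-- set of users scheduled in each slot -/
  sched : ℕ → Ω → Finset (Fin N)
  /-- channel states -/
  chan : ℕ → Ω → Fin N → Bool
  init_pos : ∀ ω i, 1 ≤ init ω i
  init_meas : Measurable[ℱ 0] init
  sched_meas : ∀ t i, MeasurableSet[ℱ t] {ω | i ∈ sched t ω}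
  chan_meas : ∀ t, Measurable[ℱ (t + 1)] (chan t)
  /-- in each slot, the channel states are independent of the past and of the action taken -/
  chan_indep_past : ∀ t, Indep (MeasurableSpace.comap (chan t) inferInstance) (ℱ t) P
  /-- in each slot, the channel states of the users are mutually independent -/
  chan_indep : ∀ t, iIndepFun (fun i ω => chan t ω i) P
  chan_law : ∀ t i, P {ω | chan t ω i = true} = ENNReal.ofReal (p (cls i))
  sched_card : ∀ t ω, (sched t ω).card = M
  /-- the scheduled users have the highest Whittle indices -/
  sched_whittle : ∀ t ω, ∀ i ∈ sched t ω, ∀ j ∉ sched t ω,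
    whittleIndex (p (cls j))
        (ages (init ω) (fun r => sched r ω) (fun r => chan r ω) t j) ≤
      whittleIndex (p (cls i))
        (ages (init ω) (fun r => sched r ω) (fun r => chan r ω) t i)

namespace WhittleSystem

variable {p : Fin 2 → ℝ} {N M : ℕ} {Ω : Type*} [MeasurableSpace Ω] {P : Measure Ω}

/-- The age of user `i` at time `t`. -/
def age (S : WhittleSystem p N M P) (t : ℕ) (ω : Ω) (i : Fin N) : ℕ :=
  ages (S.init ω) (fun r => S.sched r ω) (fun r => S.chan r ω) t i

/-- `S.Z t ω k i` is the number of users of class `k` with age `i` at time `t`, divided by the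
total number `N` of users. -/
noncomputable def Z (S : WhittleSystem p N M P) (t : ℕ) (ω : Ω) (k : Fin 2) (i : ℕ) : ℝ :=
  ((Finset.univ.filter fun j : Fin N => S.cls j = k ∧ S.age t ω j = i).card : ℝ) / N

/-- Among users of age `1`, where the indices of the two classes coincide, no user of the second
class is scheduled before a user of the first class. -/
def FirstClassFirstAtAgeOne (S : WhittleSystem p N M P) : Prop :=
  ∀ t ω, ∀ i ∈ S.sched t ω, ∀ j ∉ S.sched t ω,
    S.age t ω i = 1 → S.age t ω j = 1 → ¬ (S.cls i = 1 ∧ S.cls j = 0)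

end WhittleSystem

end WhittleAoI

namespace WhittleAoI

/-- Admissible parameters, with `n₀` a bound on the ages that may be left idle. -/
structure Admissible (p γ : Fin 2 → ℝ) (α : ℝ) (n₀ : ℕ) : Prop where
  pos₁ : 0 < p 1
  lt : p 1 < p 0
  lt_one : p 0 < 1
  γ_pos : ∀ k, 0 < γ k
  γ_sum : γ 0 + γ 1 = 1
  α_pos : 0 < α
  α_lt : α < 1
  arrivals : 1 - α < n₀ * p 1 * α

namespace Admissible

variable {p γ : Fin 2 → ℝ} {α : ℝ} {n₀ : ℕ} (h : Admissible p γ α n₀)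
include h

lemma p_pos (k : Fin 2) : 0 < p k := by
  have := h.pos₁; have := h.lt
  fin_cases k <;> simp <;> linarith

lemma p_lt_one (k : Fin 2) : p k < 1 := by
  have := h.lt; have := h.lt_one
  fin_cases k <;> simp <;> linarith

end Admissible

/-! ### Fluid trajectories and their maximum principle -/

/-- The relations between the scheduled masses `a k` of the classes and the masses `g k n` of the
users of class `k` older than `n`, imposed in one slot by Whittle's index policy. -/
structure Allocation (p γ : Fin 2 → ℝ) (α : ℝ) (n₀ : ℕ) (a : Fin 2 → ℝ)
    (g : Fin 2 → ℕ → ℝ) : Prop where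
  nonneg : ∀ k, 0 ≤ a k
  le_γ : ∀ k, a k ≤ γ k
  sum : a 0 + a 1 = α
  g_zero : ∀ k, g k 0 = γ k
  g_succ_le : ∀ k n, g k (n + 1) ≤ g k n
  g_nonneg : ∀ k n, 0 ≤ g k n
  -- The three cross-class comparisons. A second-class user older than `n ≤ n₀` outranks a
  -- first-class user of age at most `n`; a first-class user older than `n ≥ 1` outranks a
  -- second-class user of age at most `n + 1`. For `n = 0` the latter comparison is between equal
  -- indices at age 1, so it is available only through `tie`.
  first_first : ∀ n ≤ n₀, g 1 n ≤ a 1 ∨ a 0 ≤ g 0 n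
  second_first : ∀ n, 1 ≤ n → g 0 n ≤ a 0 ∨ a 1 ≤ g 1 (n + 1)
  tie : γ 0 / (1 + p 0) + γ 1 / (1 + p 1) < α → γ 0 ≤ a 0 ∨ a 1 ≤ g 1 1

/-- A fluid trajectory, with time running backwards: slot `s + 1` precedes slot `s`. -/
structure Fluid (p γ : Fin 2 → ℝ) (α : ℝ) (n₀ : ℕ) (a : ℕ → Fin 2 → ℝ)
    (g : ℕ → Fin 2 → ℕ → ℝ) : Prop where
  alloc : ∀ s, Allocation p γ α n₀ (a s) (g s)
  top : ∀ s k, g s k n₀ ≤ a s k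
  dyn : ∀ s k n, g s k (n + 1) = g (s + 1) k n - p k * min (a (s + 1) k) (g (s + 1) k n)

namespace Fluid

variable {p γ : Fin 2 → ℝ} {α : ℝ} {n₀ : ℕ} {a : ℕ → Fin 2 → ℝ} {g : ℕ → Fin 2 → ℕ → ℝ}

lemma shift (F : Fluid p γ α n₀ a g) (r : ℕ) :
    Fluid p γ α n₀ (fun s => a (s + r)) (fun s => g (s + r)) where
  alloc s := F.alloc _
  top s := F.top _
  dyn s k n := by
    have := F.dyn (s + r) k n
    rw [this, show s + r + 1 = s + 1 + r by ring]

variable (F : Fluid p γ α n₀ a g)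
include F

lemma newborn (s : ℕ) (k : Fin 2) : g s k 0 - g s k 1 = p k * a (s + 1) k := by
  have h1 := F.dyn s k 0
  rw [(F.alloc _).g_zero k, min_eq_left ((F.alloc _).le_γ k)] at h1
  rw [h1, (F.alloc _).g_zero k]; ring

lemma dyn_low {s : ℕ} {k : Fin 2} {n : ℕ} (h : a (s + 1) k ≤ g (s + 1) k n) :
    g s k (n + 1) = g (s + 1) k n - p k * a (s + 1) k := by
  rw [F.dyn, min_eq_left h]

lemma dyn_high {s : ℕ} {k : Fin 2} {n : ℕ} (h : g (s + 1) k n ≤ a (s + 1) k) :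
    g s k (n + 1) = (1 - p k) * g (s + 1) k n := by
  rw [F.dyn, min_eq_right h]; ring

lemma mass_eq {s : ℕ} {k : Fin 2} {n : ℕ} (h : a (s + 1) k ≤ g (s + 1) k (n + 1)) :
    g s k (n + 1) - g s k (n + 2) = g (s + 1) k n - g (s + 1) k (n + 1) := by
  rw [F.dyn_low h, F.dyn_low (h.trans ((F.alloc _).g_succ_le k n))]; ring

variable (H : Admissible p γ α n₀)
include H

lemma mass_le_prev (s : ℕ) (k : Fin 2) (n : ℕ) :
    g s k (n + 1) - g s k (n + 2) ≤ g (s + 1) k n - g (s + 1) k (n + 1) := by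
  have h1 := (F.alloc (s + 1)).g_succ_le k n
  have h2 := mul_le_mul_of_nonneg_left (min_le_min_left (a (s + 1) k) h1) (H.p_pos k).le
  rw [F.dyn s k n, F.dyn s k (n + 1)]
  linarith

lemma le_mass_prev (s : ℕ) (k : Fin 2) (n : ℕ) :
    (1 - p k) * (g (s + 1) k n - g (s + 1) k (n + 1)) ≤ g s k (n + 1) - g s k (n + 2) := by
  have h1 := (F.alloc (s + 1)).g_succ_le k n
  have h2 : min (a (s + 1) k) (g (s + 1) k n) - min (a (s + 1) k) (g (s + 1) k (n + 1)) ≤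
      g (s + 1) k n - g (s + 1) k (n + 1) := by
    rcases le_total (a (s + 1) k) (g (s + 1) k (n + 1)) with h | h
    · rw [min_eq_left h, min_eq_left (h.trans h1)]; linarith
    · rw [min_eq_right h]; linarith [min_le_right (a (s + 1) k) (g (s + 1) k n)]
  have h3 := mul_le_mul_of_nonneg_left h2 (H.p_pos k).le
  rw [F.dyn s k n, F.dyn s k (n + 1)]
  linarith

/-- The users of age `n + 1` are what remains of the cohort born `n + 1` slots earlier, and a cohort
never grows. -/
lemma mass_le (s : ℕ) (k : Fin 2) (n : ℕ) :
    g s k n - g s k (n + 1) ≤ p k * a (s + n + 1) k := by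
  induction n generalizing s with
  | zero => exact (F.newborn s k).le
  | succ n ih =>
    refine (F.mass_le_prev H s k n).trans ((ih (s + 1)).trans_eq ?_)
    rw [show s + 1 + n + 1 = s + (n + 1) + 1 by ring]

lemma le_mass (s : ℕ) (k : Fin 2) (n : ℕ) :
    (1 - p k) ^ n * (p k * a (s + n + 1) k) ≤ g s k n - g s k (n + 1) := by
  induction n generalizing s with
  | zero => simpa using (F.newborn s k).ge
  | succ n ih =>
    refine le_trans ?_ (F.le_mass_prev H s k n)
    have := mul_le_mul_of_nonneg_left (ih (s + 1)) (sub_nonneg.2 (H.p_lt_one k).le)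
    rw [show s + 1 + n + 1 = s + (n + 1) + 1 by ring] at this
    rwa [pow_succ', mul_assoc]

/-- A cohort keeps at least the fraction `1 - p k > 0` of its mass in each slot, so it can be empty
only if it was born empty. -/
lemma idle_of_mass_eq_zero {s : ℕ} {k : Fin 2} {n : ℕ} (h : g s k n = g s k (n + 1)) :
    a (s + n + 1) k = 0 := by
  have h1 := F.le_mass H s k n
  have h2 := (F.alloc (s + n + 1)).nonneg k
  have h3 : 0 < (1 - p k) ^ n * p k := mul_pos (pow_pos (sub_pos.2 (H.p_lt_one k)) n) (H.p_pos k)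
  nlinarith

/-- If the first class is now served only above age `n + 1`, the cohort of age `n + 1` has never
been served, or else was empty from birth. Its mass is thus exactly the number of successes `n + 1`
slots ago. -/
lemma mass_first {s n : ℕ} (hn : n + 1 ≤ n₀) (h : a s 0 ≤ g s 0 (n + 1)) :
    g s 0 n - g s 0 (n + 1) = p 0 * a (s + n + 1) 0 := by
  induction n generalizing s with
  | zero => exact F.newborn s 0
  | succ n ih =>
    by_cases h1 : a (s + 1) 0 ≤ g (s + 1) 0 (n + 1)
    · rw [F.mass_eq h1, ih (by omega) h1, show s + 1 + n + 1 = s + (n + 1) + 1 by ring]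
    · have A := F.alloc s
      have A' := F.alloc (s + 1)
      push Not at h1
      have h2 := (A'.first_first (n + 1) (by omega)).resolve_right (not_le.2 h1)
      have h3 := F.dyn_high h1.le
      have h4 := F.dyn_high h2
      have h5 := mul_nonneg (H.p_pos 0).le (A'.g_nonneg 0 (n + 1))
      have h6 := mul_nonneg (H.p_pos 1).le (A'.g_nonneg 1 (n + 1))
      -- In slot `s + 1` both classes were served completely above age `n + 1`, leaving less than
      -- `α` above age `n + 2` in slot `s`. So the scheduled users cannot all be older than `n + 2`.
      have h7 : g s 0 (n + 1) ≤ a s 0 :=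
        (A.second_first (n + 1) (by omega)).resolve_right (by
          have := A.sum; have := A'.sum; intro h8; nlinarith)
      have h8 : g s 0 (n + 1) = g s 0 (n + 1 + 1) :=
        le_antisymm (h7.trans h) (A.g_succ_le 0 (n + 1))
      rw [F.idle_of_mass_eq_zero H h8, h8]; ring

/-- Counterpart of `mass_first` for the second class, as a lower bound. A cohort can be served too
early only at age 1, and `Λ` bounds the mass then served. Once ties are excluded it is used with `Λ
= 0`; the positive value serves to exclude them. -/
lemma mass_second {s n : ℕ} {M Λ : ℝ} (hM : ∀ s, a s 0 ≤ M) (hΛ : 0 ≤ Λ)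
    (hloss : ∀ s, γ 0 ≤ a s 0 ∨ a s 1 - g s 1 1 ≤ Λ)
    (hn : n + 1 ≤ n₀) (h : a s 1 ≤ g s 1 (n + 1)) :
    p 1 * (α - M - Λ) ≤ g s 1 n - g s 1 (n + 1) := by
  have hpΛ := mul_nonneg H.pos₁.le hΛ
  induction n generalizing s with
  | zero =>
    rw [F.newborn s 1]
    have := mul_le_mul_of_nonneg_left (hM (s + 1)) H.pos₁.le
    have := (F.alloc (s + 1)).sum
    rw [show a (s + 1) 1 = α - a (s + 1) 0 by linarith]
    linarith
  | succ n ih =>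
    by_cases h1 : a (s + 1) 1 ≤ g (s + 1) 1 (n + 1)
    · rw [F.mass_eq h1]; exact ih (by omega) h1
    · have A := F.alloc s
      have A' := F.alloc (s + 1)
      push Not at h1
      -- If all first-class users older than `n` were served as well, then, as in `mass_first`, the
      -- cohort turns out to be empty from birth. The second class was then idle at its birth, so `α
      -- ≤ M` and the claimed lower bound is nonpositive.
      have key : g (s + 1) 0 n ≤ a (s + 1) 0 →
          p 1 * (α - M - Λ) ≤ g s 1 (n + 1) - g s 1 (n + 1 + 1) := by
        intro h2
        have h3 := F.dyn_high h1.le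
        have h4 := F.dyn_high h2
        have h5 := mul_nonneg (H.p_pos 0).le (A'.g_nonneg 0 n)
        have h6 := mul_nonneg (H.p_pos 1).le (A'.g_nonneg 1 (n + 1))
        have h7 : g s 1 (n + 1) ≤ a s 1 := (A.first_first (n + 1) (by omega)).resolve_right (by
          have := A.sum; have := A'.sum; intro h8; nlinarith)
        have h8 : g s 1 (n + 1) = g s 1 (n + 1 + 1) :=
          le_antisymm (h7.trans h) (A.g_succ_le 1 (n + 1))
        have h9 := F.idle_of_mass_eq_zero H h8
        have h10 := (F.alloc (s + (n + 1) + 1)).sum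
        have h11 := hM (s + (n + 1) + 1)
        rw [← h8, sub_self]
        exact mul_nonpos_of_nonneg_of_nonpos H.pos₁.le (by linarith)
      rcases Nat.eq_zero_or_pos n with rfl | hn'
      · rcases hloss (s + 1) with h2 | h2
        · exact key ((A'.g_zero 0).trans_le h2)
        · have h3 := F.dyn_high h1.le
          have h4 := F.newborn s 1
          have h5 := F.newborn (s + 1) 1
          rw [A.g_zero] at h4
          rw [A'.g_zero] at h5
          have h6 := mul_le_mul_of_nonneg_left h2 H.pos₁.le
          have h7 := mul_le_mul_of_nonneg_left (hM (s + 1 + 1)) H.pos₁.le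
          have h8 := (F.alloc (s + 1 + 1)).sum
          rw [show a (s + 1 + 1) 1 = α - a (s + 1 + 1) 0 by linarith] at h5
          simp only [zero_add] at h3 h4 h5 h6 h7 ⊢
          linarith
      · obtain ⟨m, rfl⟩ : ∃ m, n = m + 1 := ⟨n - 1, by omega⟩
        exact key ((A'.second_first (m + 1) (by omega)).resolve_right (not_le.2 h1))

/-- The first class is never scheduled more than a convex combination of its past. -/
lemma upper_step {s : ℕ} {M Λ : ℝ} (hM : ∀ s, a s 0 ≤ M) (hΛ : 0 ≤ Λ)
    (hloss : ∀ s, γ 0 ≤ a s 0 ∨ a s 1 - g s 1 1 ≤ Λ)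
    (htie : γ 0 ≤ a (s + 1) 0 ∨ a (s + 1) 1 ≤ g (s + 1) 1 1) :
    a s 0 ≤ (1 - p 0) * a (s + 1) 0 + p 0 * M ∨
      a s 0 ≤ (1 - p 1) * a (s + 1) 0 + p 1 * (M + Λ) := by
  classical
  have A := F.alloc s
  have A' := F.alloc (s + 1)
  by_cases h0 : γ 0 ≤ a (s + 1) 0
  · left
    have h1 := A.le_γ 0
    have h2 := mul_le_mul_of_nonneg_left (hM (s + 1)) (H.p_pos 0).le
    nlinarith
  -- The least such `n = m + 1` locates the threshold of the first class in slot `s + 1`: some, but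
  -- not necessarily all, users of age `m + 1` are served.
  have hex : ∃ n, g (s + 1) 0 n ≤ a (s + 1) 0 := ⟨n₀, F.top _ _⟩
  obtain ⟨m, hm⟩ : ∃ m, Nat.find hex = m + 1 := by
    refine ⟨Nat.find hex - 1, ?_⟩
    have : Nat.find hex ≠ 0 := by
      intro h
      have := Nat.find_spec hex
      rw [h, A'.g_zero] at this
      exact h0 this
    omega
  have hle : m + 1 ≤ n₀ := hm ▸ Nat.find_min' hex (F.top _ _)
  have hspec : g (s + 1) 0 (m + 1) ≤ a (s + 1) 0 := hm ▸ Nat.find_spec hex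
  have hmin : a (s + 1) 0 < g (s + 1) 0 m := not_le.1 (Nat.find_min hex (by omega))
  have h1 : a (s + 1) 1 ≤ g (s + 1) 1 (m + 1) := by
    rcases Nat.eq_zero_or_pos m with rfl | hm'
    · exact htie.resolve_left h0
    · exact (A'.second_first m hm').resolve_left (not_le.2 hmin)
  -- Slot `s` is compared at the same age `m + 1`. Either the second class is served entirely above
  -- it, and the cohort entering that tail is bounded below by `mass_second`; or the first class is
  -- served only above it, and the entering cohort is at most `p 0 * M`.
  rcases A.first_first (m + 1) hle with h2 | h2
  · right
    have h3 := F.mass_second H hM hΛ hloss hle h1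
    rw [F.dyn_low (h1.trans (A'.g_succ_le 1 m))] at h2
    have := A.sum
    have := A'.sum
    rw [show a (s + 1) 1 = α - a (s + 1) 0 by linarith] at h1 h2
    linarith
  · left
    rw [F.dyn_low hmin.le] at h2
    have h3 := F.mass_le H (s + 1) 0 m
    have h4 := mul_le_mul_of_nonneg_left (hM (s + 1 + m + 1)) (H.p_pos 0).le
    linarith

/-- The first class is never scheduled less than a convex combination of its past. -/
lemma lower_step {s : ℕ} {m : ℝ} (hm : ∀ s, m ≤ a s 0)
    (htie : γ 0 ≤ a s 0 ∨ a s 1 ≤ g s 1 1) :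
    (1 - p 0) * a (s + 1) 0 + p 0 * m ≤ a s 0 ∨
      (1 - p 1) * a (s + 1) 0 + p 1 * m ≤ a s 0 := by
  classical
  have A := F.alloc s
  have A' := F.alloc (s + 1)
  have hn₀ : n₀ ≠ 0 := by
    rintro rfl
    have h1 := H.arrivals
    have h2 := H.α_lt
    push_cast at h1
    linarith
  -- Here the threshold of the second class is used. The shift to `n + 1` matches `second_first`,
  -- which pairs tail `n` of the first class with tail `n + 1` of the second.
  have hex : ∃ n, g (s + 1) 1 (n + 1) ≤ a (s + 1) 1 :=
    ⟨n₀ - 1, by rw [Nat.sub_add_cancel (Nat.pos_of_ne_zero hn₀)]; exact F.top _ _⟩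
  set n := Nat.find hex with hn
  have hle : n + 1 ≤ n₀ := by
    have : n ≤ n₀ - 1 := Nat.find_min' hex (by
      rw [Nat.sub_add_cancel (Nat.pos_of_ne_zero hn₀)]; exact F.top _ _)
    omega
  have hspec : g (s + 1) 1 (n + 1) ≤ a (s + 1) 1 := Nat.find_spec hex
  have h1 : a (s + 1) 0 ≤ g (s + 1) 0 n := by
    rcases Nat.eq_zero_or_pos n with h | h
    · rw [h, A'.g_zero]; exact A'.le_γ 0
    · have h2 : ¬ g (s + 1) 1 n ≤ a (s + 1) 1 := by
        have := Nat.find_min hex (m := n - 1) (by omega)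
        rwa [Nat.sub_add_cancel h] at this
      exact (A'.first_first n (by omega)).resolve_left h2
  have h2 : g s 0 n ≤ a s 0 ∨ a s 1 ≤ g s 1 (n + 1) := by
    rcases Nat.eq_zero_or_pos n with h | h
    · rw [h, A.g_zero]; exact htie
    · exact A.second_first n h
  rcases h2 with h2 | h2
  · left
    rcases Nat.eq_zero_or_pos n with h | h
    · rw [h, A.g_zero] at h2
      have h3 := A'.le_γ 0
      have h4 := mul_le_mul_of_nonneg_left (hm (s + 1)) (H.p_pos 0).le
      linarith
    · obtain ⟨r, hr⟩ : ∃ r, n = r + 1 := ⟨n - 1, by omega⟩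
      rw [hr] at h1 h2
      rw [F.dyn_low (h1.trans (A'.g_succ_le 0 r))] at h2
      have h3 := F.mass_first H (by omega) h1
      have h4 := mul_le_mul_of_nonneg_left (hm (s + 1 + r + 1)) (H.p_pos 0).le
      linarith
  · right
    have := A.sum
    have := A'.sum
    have key : g s 1 (n + 1) ≤ (1 - p 1) * a (s + 1) 1 + p 1 * (α - m) := by
      rcases le_total (a (s + 1) 1) (g (s + 1) 1 n) with h3 | h3
      · rw [F.dyn_low h3]
        have h4 := F.mass_le H (s + 1) 1 n
        have h5 := mul_le_mul_of_nonneg_left (hm (s + 1 + n + 1)) H.pos₁.le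
        have := (F.alloc (s + 1 + n + 1)).sum
        rw [show a (s + 1 + n + 1) 1 = α - a (s + 1 + n + 1) 0 by linarith] at h4
        linarith
      · rw [F.dyn_high h3]
        have h4 := mul_le_mul_of_nonneg_left h3 (sub_nonneg.2 (H.p_lt_one 1).le)
        have h5 := hm (s + 1)
        have h6 := A'.nonneg 1
        have h7 : 0 ≤ p 1 * (α - m) := mul_nonneg H.pos₁.le (by linarith)
        linarith
    rw [show a (s + 1) 1 = α - a (s + 1) 0 by linarith] at key
    linarith

end Fluid

end WhittleAoI

namespace WhittleAoI

namespace Fluid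

variable {p γ : Fin 2 → ℝ} {α : ℝ} {n₀ : ℕ} {a : ℕ → Fin 2 → ℝ} {g : ℕ → Fin 2 → ℕ → ℝ}

/-! ### Excluding ties at age 1 -/

section Tie

variable (F : Fluid p γ α n₀ a g) (H : Admissible p γ α n₀) {c : ℝ}
  (hc : (p 0 - p 1) * c = 1 - α - p 1 * α)
include F H hc

/-- The meaning of `c`: it is the scheduled mass of the first class for which the users older than 1
in the next slot have mass exactly `α`. Below `c` nobody of age 1 needs to be served; above `c`
somebody must be. -/
lemma mass_gt_one (s : ℕ) : g s 0 1 + g s 1 1 = α - (p 0 - p 1) * (a (s + 1) 0 - c) := by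
  have h1 := F.newborn s 0
  have h2 := F.newborn s 1
  have h3 := (F.alloc (s + 1)).sum
  have h4 := H.γ_sum
  rw [(F.alloc s).g_zero] at h1 h2
  rw [show a (s + 1) 1 = α - a (s + 1) 0 by linarith] at h2
  linarith

lemma tie_of_le {s : ℕ} (h : a (s + 1) 0 ≤ c) : a s 1 ≤ g s 1 1 := by
  by_contra! h1
  have A := F.alloc s
  have h2 := F.mass_gt_one H hc s
  have h3 := mul_nonneg (sub_pos.2 H.lt).le (sub_nonneg.2 h)
  have h4 := A.sum
  rcases A.second_first 1 le_rfl with h5 | h5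
  · linarith
  · linarith [A.g_succ_le 1 1]

/-- Above `c`, the users older than 1 do not fill the next slot. The second class then receives at
least its whole tail beyond age 1, and the condition on `c` makes the remaining capacity smaller
than `c`: the scheduled mass cannot exceed `c` twice in a row. -/
lemma lt_of_gt (hcγ : γ 0 ≤ (1 + p 0) * c) {s : ℕ} (h : c < a (s + 1) 0) (hn₀ : 1 ≤ n₀) :
    a s 0 < c := by
  have A := F.alloc s
  have h2 := F.mass_gt_one H hc s
  have h3 := mul_pos (sub_pos.2 H.lt) (sub_pos.2 h)
  have h4 := A.sum
  have h5 : a s 0 ≤ α - g s 1 1 := by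
    rcases A.first_first 1 hn₀ with h6 | h6 <;> linarith
  have h6 := F.newborn s 1
  have h7 := (F.alloc (s + 1)).sum
  have h8 := H.γ_sum
  have h9 := mul_lt_mul_of_pos_left h H.pos₁
  rw [A.g_zero, show a (s + 1) 1 = α - a (s + 1) 0 by linarith] at h6
  linarith

/-- If the first class does not need to be preferred at age `1`, then ties at age `1` do not occur
in a trajectory that attains its maximum. -/
lemma le_balance (hcγ : γ 0 ≤ (1 + p 0) * c) (hn₀ : 1 ≤ n₀) (hmax : ∀ s, a s 0 ≤ a 0 0) :
    a 0 0 ≤ c := by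
  by_contra! hM
  set M := a 0 0 with hMdef
  have hd := sub_pos.2 H.lt
  have hδ := sub_pos.2 hM
  have h1 : a 1 0 ≤ c := by
    by_contra! h
    exact absurd (F.lt_of_gt H hc hcγ (s := 0) h hn₀) (not_lt.2 hM.le)
  have A := F.alloc 0
  have A1 := F.alloc 1
  have h2 := F.tie_of_le H hc (s := 0) h1
  have h3 : M ≤ g 0 0 1 := by
    rcases A.first_first 1 hn₀ with h | h
    · have h4 := F.mass_gt_one H hc 0
      have h5 := mul_nonneg hd.le (sub_nonneg.2 h1)
      have h6 := A.sum
      simp only [zero_add] at h4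
      linarith
    · exact h
  have h4 : M ≤ γ 0 - p 0 * a 1 0 := by
    have := F.newborn 0 0
    rw [A.g_zero] at this
    simp only [zero_add] at this
    linarith
  -- Without a tie in slot 1, the maximum principle applies with loss `Λ = (p 0 - p 1) * (M - c)`,
  -- by which the mass older than 1 can fall short of `α`. This loss is too small to make up for `a
  -- 1 0 ≤ c < M`.
  by_cases h5 : γ 0 ≤ a 1 0 ∨ a 1 1 ≤ g 1 1 1
  · have hΛ : 0 ≤ (p 0 - p 1) * (M - c) := mul_nonneg hd.le hδ.le
    have hloss : ∀ s, γ 0 ≤ a s 0 ∨ a s 1 - g s 1 1 ≤ (p 0 - p 1) * (M - c) := by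
      intro s
      right
      by_cases h : a s 1 ≤ g s 1 1
      · linarith
      · push Not at h
        have h6 := ((F.alloc s).second_first 1 le_rfl).resolve_right (by
          have := (F.alloc s).g_succ_le 1 1; intro h7; linarith)
        have h7 := F.mass_gt_one H hc s
        have h8 := (F.alloc s).sum
        have h9 := mul_le_mul_of_nonneg_left (hmax (s + 1)) hd.le
        linarith
    have hp0 := H.p_pos 0
    have hp1 := H.pos₁
    have h10 := sub_pos.2 (H.p_lt_one 1)
    have h11 := sub_pos.2 (H.p_lt_one 0)
    rcases F.upper_step H (s := 0) hmax hΛ hloss h5 with h6 | h6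
    · simp only [zero_add] at h6
      have : (1 - p 0) * (M - a 1 0) ≤ 0 := by linarith
      nlinarith
    · simp only [zero_add] at h6
      have h7 : (1 - p 1) * (M - a 1 0) ≤ p 1 * ((p 0 - p 1) * (M - c)) := by linarith
      have h8 : (1 + p 0) * (M - c) ≤ p 0 * (M - a 1 0) := by linarith
      have h9 : (1 - p 1) * ((1 + p 0) * (M - c)) ≤ p 0 * p 1 * (p 0 - p 1) * (M - c) := by
        have e1 := mul_le_mul_of_nonneg_left h7 hp0.le
        have e2 := mul_le_mul_of_nonneg_left h8 h10.le
        linarith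
      have h12 : p 0 * p 1 * (p 0 - p 1) < (1 - p 1) * (1 + p 0) := by
        have e1 : p 0 * p 1 ≤ 1 := by nlinarith
        have e2 : p 0 * p 1 * (p 0 - p 1) ≤ p 0 - p 1 := by nlinarith
        nlinarith
      nlinarith
  -- With a tie in slot 1, the first class is served above age 1 there, so `a 1 0 ≥ γ 0 - p 0 * M`.
  -- Together with `M ≤ γ 0 - p 0 * a 1 0` this gives `M ≤ a 1 0`, a contradiction.
  · push Not at h5
    have h6 := (A1.second_first 1 le_rfl).resolve_right (by
      have := A1.g_succ_le 1 1; intro h7; linarith [h5.2])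
    have h7 := F.newborn 1 0
    rw [A1.g_zero] at h7
    have h8 := mul_le_mul_of_nonneg_left (hmax (1 + 1)) (H.p_pos 0).le
    have h9 := mul_pos (sub_pos.2 (H.p_lt_one 0)) (sub_pos.2 (h1.trans_lt hM))
    linarith

end Tie

/-! ### Comparison of stationary trajectories -/

lemma g_eq_of_const {a' : ℕ → Fin 2 → ℝ} {g' : ℕ → Fin 2 → ℕ → ℝ} {b : Fin 2 → ℝ}
    (F : Fluid p γ α n₀ a g) (F' : Fluid p γ α n₀ a' g')
    (h : ∀ s k, a s k = b k) (h' : ∀ s k, a' s k = b k) (k : Fin 2) (n : ℕ) (s : ℕ) :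
    g s k n = g' s k n := by
  induction n generalizing s with
  | zero => rw [(F.alloc s).g_zero, (F'.alloc s).g_zero]
  | succ n ih => rw [F.dyn, F'.dyn, h, h', ih]

/-- The map `x ↦ x - p * min b x` increases in `x` because `p < 1` and decreases in `b`: serving a
class more makes all its tails smaller. -/
lemma g_le_of_const {a' : ℕ → Fin 2 → ℝ} {g' : ℕ → Fin 2 → ℕ → ℝ} {b b' : Fin 2 → ℝ}
    (F : Fluid p γ α n₀ a g) (F' : Fluid p γ α n₀ a' g') (H : Admissible p γ α n₀)
    (h : ∀ s k, a s k = b k) (h' : ∀ s k, a' s k = b' k) (k : Fin 2) (hk : b k ≤ b' k)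
    (n : ℕ) (s : ℕ) :
    g' s k n ≤ g s k n := by
  induction n generalizing s with
  | zero => rw [(F.alloc s).g_zero, (F'.alloc s).g_zero]
  | succ n ih =>
    have ih := ih (s + 1)
    rw [F.dyn, F'.dyn, h, h']
    have h1 : min (b k) (g (s + 1) k n) - min (b' k) (g' (s + 1) k n) ≤
        g (s + 1) k n - g' (s + 1) k n := by
      rcases le_total (b' k) (g' (s + 1) k n) with h1 | h1
      · rw [min_eq_left h1]; linarith [min_le_left (b k) (g (s + 1) k n)]
      · rw [min_eq_right h1]; linarith [min_le_right (b k) (g (s + 1) k n)]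
    have h2 := mul_le_mul_of_nonneg_left h1 (H.p_pos k).le
    have h3 := mul_nonneg (sub_pos.2 (H.p_lt_one k)).le (sub_nonneg.2 ih)
    linarith

lemma snd_of_const (F : Fluid p γ α n₀ a g) {b : ℝ} (h : ∀ s, a s 0 = b) (s : ℕ) (k : Fin 2) :
    a s k = if k = 0 then b else α - b := by
  have h1 := (F.alloc s).sum
  have h2 := h s
  fin_cases k
  · simpa using h2
  · simp; linarith

/-- A stationary trajectory is unique. -/
lemma const_unique {a' : ℕ → Fin 2 → ℝ} {g' : ℕ → Fin 2 → ℕ → ℝ} {b b' : ℝ}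
    (F : Fluid p γ α n₀ a g) (F' : Fluid p γ α n₀ a' g') (H : Admissible p γ α n₀)
    (h : ∀ s, a s 0 = b) (h' : ∀ s, a' s 0 = b')
    (htie : γ 0 ≤ a 0 0 ∨ a 0 1 ≤ g 0 1 1) : b' ≤ b := by
  classical
  by_contra! hb
  have A := F.alloc 0
  have A' := F'.alloc 0
  -- At the first-class threshold of `F`, the trajectory `F'` has a smaller first-class tail and a
  -- larger second-class tail. The priority rule of `F'` there contradicts its serving the first
  -- class more.
  have hex : ∃ n, g 0 0 n ≤ a 0 0 := ⟨n₀, F.top _ _⟩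
  have hle : Nat.find hex ≤ n₀ := Nat.find_min' hex (F.top _ _)
  have hspec : g 0 0 (Nat.find hex) ≤ a 0 0 := Nat.find_spec hex
  have hγ := A'.le_γ 0
  rw [h'] at hγ
  have h1 : a 0 1 ≤ g 0 1 (Nat.find hex) := by
    rcases hn : Nat.find hex with _ | m
    · rw [hn, A.g_zero, h] at hspec
      linarith
    · have hmin : ¬ g 0 0 m ≤ a 0 0 := Nat.find_min hex (by omega)
      rcases Nat.eq_zero_or_pos m with rfl | hm
      · exact htie.resolve_left (by rw [h]; linarith)
      · exact (A.second_first m hm).resolve_left hmin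
  have h2 : g' 0 0 (Nat.find hex) ≤ g 0 0 (Nat.find hex) :=
    F.g_le_of_const F' H (F.snd_of_const h) (F'.snd_of_const h') 0 (by simpa using hb.le) _ _
  have h3 : g 0 1 (Nat.find hex) ≤ g' 0 1 (Nat.find hex) :=
    F'.g_le_of_const F H (F'.snd_of_const h') (F.snd_of_const h) 1
      (by simp only [one_ne_zero, if_false]; linarith) _ _
  have h4 := A.sum
  have h5 := A'.sum
  have h0 := h 0
  have h0' := h' 0
  rcases A'.first_first _ hle with h6 | h6
  · linarith
  · linarith

end Fluid

/-! ### Compactness and uniqueness of trajectories with an infinite past -/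

/-- Trajectories over an unbounded past in which only the most recent `L` slots follow the fluid
dynamics, up to an error `ε`. -/
structure ApproxFluid (p γ : Fin 2 → ℝ) (α : ℝ) (n₀ : ℕ) (ε : ℝ) (L : ℕ)
    (x : (ℕ → Fin 2 → ℝ) × (ℕ → Fin 2 → ℕ → ℝ)) : Prop where
  alloc : ∀ s, Allocation p γ α n₀ (x.1 s) (x.2 s)
  top : ∀ s < L, ∀ k, x.2 s k n₀ ≤ x.1 s k
  dyn : ∀ s < L, ∀ k n,
    |x.2 s k (n + 1) - (x.2 (s + 1) k n - p k * min (x.1 (s + 1) k) (x.2 (s + 1) k n))| ≤ ε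

section Compactness

variable {p γ : Fin 2 → ℝ} {α : ℝ} {n₀ : ℕ}

lemma Allocation.g_le {a : Fin 2 → ℝ} {g : Fin 2 → ℕ → ℝ} (A : Allocation p γ α n₀ a g)
    (k : Fin 2) (n : ℕ) : g k n ≤ γ k := by
  induction n with
  | zero => exact (A.g_zero k).le
  | succ n ih => exact (A.g_succ_le k n).trans ih

lemma isClosed_allocation (p γ : Fin 2 → ℝ) (α : ℝ) (n₀ : ℕ) :
    IsClosed {x : (Fin 2 → ℝ) × (Fin 2 → ℕ → ℝ) | Allocation p γ α n₀ x.1 x.2} := by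
  have e : {x : (Fin 2 → ℝ) × (Fin 2 → ℕ → ℝ) | Allocation p γ α n₀ x.1 x.2} =
      {x | (∀ k, 0 ≤ x.1 k) ∧ (∀ k, x.1 k ≤ γ k) ∧ x.1 0 + x.1 1 = α ∧ (∀ k, x.2 k 0 = γ k) ∧
        (∀ k n, x.2 k (n + 1) ≤ x.2 k n) ∧ (∀ k n, 0 ≤ x.2 k n) ∧
        (∀ n ≤ n₀, x.2 1 n ≤ x.1 1 ∨ x.1 0 ≤ x.2 0 n) ∧
        (∀ n, 1 ≤ n → x.2 0 n ≤ x.1 0 ∨ x.1 1 ≤ x.2 1 (n + 1)) ∧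
        (γ 0 / (1 + p 0) + γ 1 / (1 + p 1) < α → γ 0 ≤ x.1 0 ∨ x.1 1 ≤ x.2 1 1)} :=
    Set.ext fun x => ⟨fun h => ⟨h.1, h.2, h.3, h.4, h.5, h.6, h.7, h.8, h.9⟩,
      fun ⟨h1, h2, h3, h4, h5, h6, h7, h8, h9⟩ => ⟨h1, h2, h3, h4, h5, h6, h7, h8, h9⟩⟩
  rw [e]
  simp only [Set.ofPred_and, Set.ofPred_forall]
  have hle : ∀ f f' : (Fin 2 → ℝ) × (Fin 2 → ℕ → ℝ) → ℝ, Continuous f → Continuous f' →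
      IsClosed {x | f x ≤ f' x} := fun f f' h h' => isClosed_le h h'
  refine .inter (isClosed_iInter fun k => hle _ _ (by fun_prop) (by fun_prop))
    (.inter (isClosed_iInter fun k => hle _ _ (by fun_prop) (by fun_prop))
    (.inter (isClosed_eq (by fun_prop) (by fun_prop))
    (.inter (isClosed_iInter fun k => isClosed_eq (by fun_prop) (by fun_prop))
    (.inter (isClosed_iInter fun k => isClosed_iInter fun n => hle _ _ (by fun_prop) (by fun_prop))
    (.inter (isClosed_iInter fun k => isClosed_iInter fun n => hle _ _ (by fun_prop) (by fun_prop))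
    (.inter (isClosed_iInter fun n => isClosed_iInter fun _ => ?_)
    (.inter (isClosed_iInter fun n => isClosed_iInter fun _ => ?_) (isClosed_iInter fun _ => ?_))))))))
  all_goals exact (hle _ _ (by fun_prop) (by fun_prop)).union (hle _ _ (by fun_prop) (by fun_prop))

lemma isClosed_approxFluid (p γ : Fin 2 → ℝ) (α : ℝ) (n₀ : ℕ) (ε : ℝ) (L : ℕ) :
    IsClosed {x | ApproxFluid p γ α n₀ ε L x} := by
  have e : {x | ApproxFluid p γ α n₀ ε L x} =
      {x | (∀ s, Allocation p γ α n₀ (x.1 s) (x.2 s)) ∧ (∀ s < L, ∀ k, x.2 s k n₀ ≤ x.1 s k) ∧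
        ∀ s < L, ∀ k n, |x.2 s k (n + 1) -
          (x.2 (s + 1) k n - p k * min (x.1 (s + 1) k) (x.2 (s + 1) k n))| ≤ ε} :=
    Set.ext fun x => ⟨fun h => ⟨h.1, h.2, h.3⟩, fun ⟨h1, h2, h3⟩ => ⟨h1, h2, h3⟩⟩
  rw [e]
  simp only [Set.ofPred_and, Set.ofPred_forall]
  refine .inter (isClosed_iInter fun s => ?_) (.inter ?_ ?_)
  · exact (isClosed_allocation p γ α n₀).preimage
      (f := fun x : (ℕ → Fin 2 → ℝ) × (ℕ → Fin 2 → ℕ → ℝ) => (x.1 s, x.2 s)) (by fun_prop)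
  · exact isClosed_iInter fun s => isClosed_iInter fun _ => isClosed_iInter fun k =>
      isClosed_le (by fun_prop) (by fun_prop)
  · exact isClosed_iInter fun s => isClosed_iInter fun _ => isClosed_iInter fun k =>
      isClosed_iInter fun n => isClosed_le (by fun_prop) (by fun_prop)

/-- Tychonoff: all masses of class `k` lie in `[0, γ k]`, and the relations are closed under
pointwise convergence, the disjunctions being finite unions of closed conditions. -/
lemma isCompact_approxFluid (p γ : Fin 2 → ℝ) (α : ℝ) (n₀ : ℕ) (ε : ℝ) (L : ℕ) :
    IsCompact {x | ApproxFluid p γ α n₀ ε L x} := by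
  have h : IsCompact
      ((Set.univ.pi fun _ : ℕ => Set.univ.pi fun k : Fin 2 => Set.Icc 0 (γ k)) ×ˢ
        (Set.univ.pi fun _ : ℕ => Set.univ.pi fun k : Fin 2 =>
          Set.univ.pi fun _ : ℕ => Set.Icc 0 (γ k))) :=
    (isCompact_univ_pi fun _ => isCompact_univ_pi fun _ => isCompact_Icc).prod
      (isCompact_univ_pi fun _ => isCompact_univ_pi fun _ => isCompact_univ_pi fun _ =>
        isCompact_Icc)
  refine h.of_isClosed_subset (isClosed_approxFluid ..) fun x hx => ⟨?_, ?_⟩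
  · exact fun s _ k _ => ⟨(hx.alloc s).nonneg k, (hx.alloc s).le_γ k⟩
  · exact fun s _ k _ n _ => ⟨(hx.alloc s).g_nonneg k n, (hx.alloc s).g_le k n⟩

lemma Fluid.approxFluid {x : (ℕ → Fin 2 → ℝ) × (ℕ → Fin 2 → ℕ → ℝ)}
    (F : Fluid p γ α n₀ x.1 x.2) {ε : ℝ} (hε : 0 ≤ ε) (L : ℕ) : ApproxFluid p γ α n₀ ε L x where
  alloc := F.alloc
  top s _ := F.top s
  dyn s _ k n := by rw [F.dyn s k n, sub_self, abs_zero]; exact hε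

lemma ApproxFluid.mono {x : (ℕ → Fin 2 → ℝ) × (ℕ → Fin 2 → ℕ → ℝ)} {ε ε' : ℝ} {L L' : ℕ}
    (h : ApproxFluid p γ α n₀ ε L x) (hε : ε ≤ ε') (hL : L' ≤ L) :
    ApproxFluid p γ α n₀ ε' L' x where
  alloc := h.alloc
  top s hs := h.top s (hs.trans_le hL)
  dyn s hs k n := (h.dyn s (hs.trans_le hL) k n).trans hε

lemma fluid_of_forall_approxFluid {x : (ℕ → Fin 2 → ℝ) × (ℕ → Fin 2 → ℕ → ℝ)}
    (h : ∀ L : ℕ, ApproxFluid p γ α n₀ (1 / (L + 1)) L x) : Fluid p γ α n₀ x.1 x.2 where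
  alloc := (h 0).alloc
  top s := (h (s + 1)).top s (Nat.lt_succ_self s)
  dyn s k n := by
    have h1 : |x.2 s k (n + 1) -
        (x.2 (s + 1) k n - p k * min (x.1 (s + 1) k) (x.2 (s + 1) k n))| ≤ 0 :=
      ge_of_tendsto tendsto_one_div_add_atTop_nhds_zero_nat
        (Filter.eventually_atTop.2 ⟨s + 1, fun L hL => (h L).dyn s hL k n⟩)
    exact sub_eq_zero.1 (abs_nonpos_iff.1 h1)

lemma setOf_fluid_eq : {x : (ℕ → Fin 2 → ℝ) × (ℕ → Fin 2 → ℕ → ℝ) | Fluid p γ α n₀ x.1 x.2} =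
    ⋂ L : ℕ, {x | ApproxFluid p γ α n₀ (1 / (L + 1)) L x} := by
  ext x
  simp only [Set.mem_ofPred_eq, Set.mem_iInter]
  exact ⟨fun h L => h.approxFluid (by positivity) L, fluid_of_forall_approxFluid⟩

lemma isCompact_fluid :
    IsCompact {x : (ℕ → Fin 2 → ℝ) × (ℕ → Fin 2 → ℕ → ℝ) | Fluid p γ α n₀ x.1 x.2} := by
  rw [setOf_fluid_eq]
  exact (isCompact_approxFluid p γ α n₀ _ 0).of_isClosed_subset
    (isClosed_iInter fun L => isClosed_approxFluid ..) (Set.iInter_subset _ 0)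

namespace Fluid

variable {a a' : ℕ → Fin 2 → ℝ} {g g' : ℕ → Fin 2 → ℕ → ℝ}

lemma one_le (H : Admissible p γ α n₀) : 1 ≤ n₀ := by
  rcases Nat.eq_zero_or_pos n₀ with rfl | h
  · have h1 := H.arrivals
    have h2 := H.α_lt
    push_cast at h1
    linarith
  · exact h

/-- A fluid trajectory in which the first class is scheduled as much as possible. -/
lemma exists_max (F : Fluid p γ α n₀ a g) : ∃ a' g', Fluid p γ α n₀ a' g' ∧
    ∀ a'' g'', Fluid p γ α n₀ a'' g'' → ∀ s, a'' s 0 ≤ a' 0 0 := by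
  obtain ⟨x, hx, hmax⟩ := (isCompact_fluid (p := p) (γ := γ) (α := α) (n₀ := n₀)).exists_isMaxOn
    ⟨(a, g), F⟩ (f := fun x => x.1 0 0) (by fun_prop)
  refine ⟨x.1, x.2, hx, fun a'' g'' F'' s => ?_⟩
  have := hmax (a := (fun r => a'' (r + s), fun r => g'' (r + s))) (F''.shift s)
  simpa using this

/-- A fluid trajectory in which the first class is scheduled as little as possible. -/
lemma exists_min (F : Fluid p γ α n₀ a g) : ∃ a' g', Fluid p γ α n₀ a' g' ∧
    ∀ a'' g'', Fluid p γ α n₀ a'' g'' → ∀ s, a' 0 0 ≤ a'' s 0 := by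
  obtain ⟨x, hx, hmin⟩ := (isCompact_fluid (p := p) (γ := γ) (α := α) (n₀ := n₀)).exists_isMinOn
    ⟨(a, g), F⟩ (f := fun x => x.1 0 0) (by fun_prop)
  refine ⟨x.1, x.2, hx, fun a'' g'' F'' s => ?_⟩
  have := hmin (a := (fun r => a'' (r + s), fun r => g'' (r + s))) (F''.shift s)
  simpa using this

/-- No user of the second class and age `1` is scheduled while one of the first class is not. -/
lemma no_tie (F : Fluid p γ α n₀ a g) (H : Admissible p γ α n₀) (s : ℕ) :
    γ 0 ≤ a s 0 ∨ a s 1 ≤ g s 1 1 := by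
  by_cases hα : γ 0 / (1 + p 0) + γ 1 / (1 + p 1) < α
  · exact (F.alloc s).tie hα
  right
  obtain ⟨a', g', F', hmax⟩ := F.exists_max
  have hd := sub_pos.2 H.lt
  obtain ⟨c, hc⟩ : ∃ c, (p 0 - p 1) * c = 1 - α - p 1 * α :=
    -- After multiplication by the denominators, the negation of the tie-rule condition on `α`
    -- becomes `γ 0 ≤ (1 + p 0) * c`, the hypothesis of `le_balance`.
    ⟨(1 - α - p 1 * α) / (p 0 - p 1), mul_div_cancel₀ _ hd.ne'⟩
  have hcγ : γ 0 ≤ (1 + p 0) * c := by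
    have h0 : 0 < 1 + p 0 := by linarith [H.p_pos 0]
    have h1 : 0 < 1 + p 1 := by linarith [H.p_pos 1]
    have h2 : α * ((1 + p 0) * (1 + p 1)) ≤ γ 0 * (1 + p 1) + γ 1 * (1 + p 0) := by
      rw [div_add_div _ _ h0.ne' h1.ne', not_lt, le_div_iff₀ (mul_pos h0 h1)] at hα
      linarith
    have h3 := H.γ_sum
    have h4 : 0 ≤ (p 0 - p 1) * ((1 + p 0) * c - γ 0) := by
      have : (p 0 - p 1) * ((1 + p 0) * c - γ 0) =
          (1 + p 0) * (1 - α - p 1 * α) - (p 0 - p 1) * γ 0 := by rw [← hc]; ring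
      rw [this]
      have : γ 1 = 1 - γ 0 := by linarith
      rw [this] at h2
      linarith
    have := nonneg_of_mul_nonneg_right h4 hd
    linarith
  exact F.tie_of_le H hc
    ((hmax a g F (s + 1)).trans (F'.le_balance H hc hcγ (one_le H) fun s => hmax a' g' F' s))

/-- A trajectory that attains the global maximum is stationary. -/
lemma const_of_max (H : Admissible p γ α n₀) {M : ℝ}
    (hM : ∀ a g, Fluid p γ α n₀ a g → ∀ s, a s 0 ≤ M) (F : Fluid p γ α n₀ a g)
    (h : a 0 0 = M) (s : ℕ) : a s 0 = M := by
  induction s with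
  | zero => exact h
  | succ s ih =>
    refine le_antisymm (hM a g F _) ?_
    have h1 := F.upper_step H (s := s) (hM a g F) le_rfl
      (fun s => (F.no_tie H s).imp_right sub_nonpos.2) (F.no_tie H (s + 1))
    rw [ih] at h1
    have h2 := sub_pos.2 (H.p_lt_one 0)
    have h3 := sub_pos.2 (H.p_lt_one 1)
    rcases h1 with h1 | h1
    · exact le_of_mul_le_mul_left (by linarith) h2
    · exact le_of_mul_le_mul_left (by linarith) h3

/-- A trajectory that attains the global minimum is stationary. -/
lemma const_of_min (H : Admissible p γ α n₀) {m : ℝ}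
    (hm : ∀ a g, Fluid p γ α n₀ a g → ∀ s, m ≤ a s 0) (F : Fluid p γ α n₀ a g)
    (h : a 0 0 = m) (s : ℕ) : a s 0 = m := by
  induction s with
  | zero => exact h
  | succ s ih =>
    refine le_antisymm ?_ (hm a g F _)
    have h1 := F.lower_step H (s := s) (hm a g F) (F.no_tie H s)
    rw [ih] at h1
    have h2 := sub_pos.2 (H.p_lt_one 0)
    have h3 := sub_pos.2 (H.p_lt_one 1)
    rcases h1 with h1 | h1
    · exact le_of_mul_le_mul_left (by linarith) h2
    · exact le_of_mul_le_mul_left (by linarith) h3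

/-- There is at most one fluid trajectory with an unbounded past. -/
theorem unique (F : Fluid p γ α n₀ a g) (F' : Fluid p γ α n₀ a' g')
    (H : Admissible p γ α n₀) (s : ℕ) (k : Fin 2) (n : ℕ) : g s k n = g' s k n := by
  obtain ⟨a₁, g₁, F₁, hmax⟩ := F.exists_max
  obtain ⟨a₂, g₂, F₂, hmin⟩ := F.exists_min
  have h1 := const_of_max H hmax F₁ rfl
  have h2 := const_of_min H hmin F₂ rfl
  have h3 := F₂.const_unique F₁ H h2 h1 (F₂.no_tie H 0)
  have h4 : ∀ a g, Fluid p γ α n₀ a g → ∀ s, a s 0 = a₁ 0 0 := fun a g F s =>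
    le_antisymm (hmax a g F s) (h3.trans (hmin a g F s))
  exact F.g_eq_of_const F' (F.snd_of_const (h4 a g F)) (F'.snd_of_const (h4 a' g' F')) k n s

end Fluid

/-- A trajectory that has followed the fluid dynamics for a long time with a small error is close to
the stationary trajectory. -/
theorem exists_approxFluid_close {a : ℕ → Fin 2 → ℝ} {g : ℕ → Fin 2 → ℕ → ℝ}
    (F : Fluid p γ α n₀ a g) (H : Admissible p γ α n₀) {δ : ℝ} (hδ : 0 < δ) (K : ℕ) :
    ∃ L : ℕ, ∀ x, ApproxFluid p γ α n₀ (1 / (L + 1)) L x →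
      ∀ k, ∀ n ≤ K, |x.2 0 k n - g 0 k n| < δ := by
  -- Nested compact sets: their intersection consists of fluid trajectories, all with the tails `g`,
  -- so one of them lies in the open set of trajectories close to `g` on ages up to `K`.
  have hdir : Directed (· ⊇ ·)
      fun L : ℕ => {x | ApproxFluid p γ α n₀ (1 / ((L : ℝ) + 1)) L x} := by
    refine directed_of_isDirected_le fun L L' hL x hx => ?_
    exact ApproxFluid.mono hx (Nat.one_div_le_one_div hL) hL
  obtain ⟨L, hL⟩ := exists_subset_nhds_of_isCompact' hdir (fun L => isCompact_approxFluid ..)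
    (fun L => isClosed_approxFluid ..)
    (U := {x | ∀ k, ∀ n ∈ Set.Iic K, |x.2 0 k n - g 0 k n| < δ}) (fun x hx => by
      rw [← setOf_fluid_eq] at hx
      have hx : Fluid p γ α n₀ x.1 x.2 := hx
      refine Filter.eventually_all.2 fun k =>
        (Filter.eventually_all_finite (Set.finite_Iic K)).2 fun n _ => ?_
      have hc : Continuous fun x : (ℕ → Fin 2 → ℝ) × (ℕ → Fin 2 → ℕ → ℝ) =>
        |x.2 0 k n - g 0 k n| := by fun_prop
      refine hc.continuousAt.eventually_lt continuousAt_const ?_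
      rw [hx.unique F H, sub_self, abs_zero]
      exact hδ)
  exact ⟨L, fun x hx => hL hx⟩

end Compactness

end WhittleAoI

namespace WhittleAoI

/-! ### Whittle's index and the alternation of the classes -/

section Index

lemma whittleIndex_strictMono {p : ℝ} (hp : 0 ≤ p) : StrictMono (whittleIndex p) := by
  refine strictMono_nat_of_lt_succ fun n => ?_
  have : whittleIndex p (n + 1) - whittleIndex p n = p * n + 1 := by
    unfold whittleIndex; push_cast; ring
  have : 0 ≤ p * n := by positivity
  linarith

lemma whittleIndex_one (p : ℝ) : whittleIndex p 1 = 1 := by simp [whittleIndex]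

lemma le_whittleIndex {p : ℝ} (hp : 0 ≤ p) (n : ℕ) : (n : ℝ) ≤ whittleIndex p n := by
  rcases Nat.eq_zero_or_pos n with rfl | h
  · simp [whittleIndex]
  · have h1 : (1 : ℝ) ≤ n := by exact_mod_cast h
    have : 0 ≤ ((n : ℝ) - 1) * p * n / 2 := by
      have := sub_nonneg.2 h1
      positivity
    unfold whittleIndex
    linarith

lemma whittleIndex_lt_of_lt {p p' : ℝ} (h : p < p') {n : ℕ} (hn : 2 ≤ n) :
    whittleIndex p n < whittleIndex p' n := by
  have h1 : (2 : ℝ) ≤ n := by exact_mod_cast hn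
  have : whittleIndex p' n - whittleIndex p n = (p' - p) * ((n - 1) * n / 2) := by
    unfold whittleIndex; ring
  have : 0 < (p' - p) * (((n : ℝ) - 1) * n / 2) :=
    mul_pos (sub_pos.2 h) (by have : (0 : ℝ) < n - 1 := by linarith
                              positivity)
  linarith

lemma whittleIndex_le_of_le {p p' : ℝ} (h : p ≤ p') (n : ℕ) :
    whittleIndex p n ≤ whittleIndex p' n := by
  have h1 : whittleIndex p' n - whittleIndex p n = (p' - p) * (((n : ℝ) - 1) * n / 2) := by
    unfold whittleIndex; ring
  have h2 : 0 ≤ ((n : ℝ) - 1) * n := by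
    rcases Nat.eq_zero_or_pos n with rfl | h
    · simp
    · have : (1 : ℝ) ≤ n := by exact_mod_cast h
      exact mul_nonneg (by linarith) (by linarith)
  have := mul_nonneg (sub_nonneg.2 h) (by linarith : 0 ≤ ((n : ℝ) - 1) * n / 2)
  linarith

/-- Below `alternationBound`, the ages of the two classes alternate in the priority order. -/
lemma whittleIndex_lt_succ {p₁ p₂ : ℝ} (h₂ : 0 < p₂) (h : p₂ < p₁) {n : ℕ}
    (hn : (n : ℝ) < alternationBound p₁ p₂) : whittleIndex p₁ n < whittleIndex p₂ (n + 1) := by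
  set D := alternationBound p₁ p₂ with hD
  set s := √(2 * (p₁ - p₂) + (p₁ + p₂) ^ 2 / 4) with hs
  have hd := sub_pos.2 h
  have hs2 : s ^ 2 = 2 * (p₁ - p₂) + (p₁ + p₂) ^ 2 / 4 := Real.sq_sqrt (by positivity)
  have hs0 : 0 ≤ s := Real.sqrt_nonneg _
  have hDs : (p₁ - p₂) * D = (p₁ + p₂) / 2 + s := by
    rw [hD, alternationBound, ← hs, ← mul_assoc, mul_one_div_cancel hd.ne', one_mul]
  have hslt : (p₁ + p₂) / 2 < s := by nlinarith
  have key : whittleIndex p₂ (n + 1) - whittleIndex p₁ n =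
      1 - ((p₁ - p₂) * n ^ 2 - (p₁ + p₂) * n) / 2 := by
    unfold whittleIndex; push_cast; ring
  have h1 : (p₁ - p₂) * ((p₁ - p₂) * D ^ 2 - (p₁ + p₂) * D) = (p₁ - p₂) * 2 := by
    have : (p₁ - p₂) * ((p₁ - p₂) * D ^ 2 - (p₁ + p₂) * D) =
        ((p₁ - p₂) * D) ^ 2 - (p₁ + p₂) * ((p₁ - p₂) * D) := by ring
    rw [this, hDs]; nlinarith
  have h2 := mul_left_cancel₀ hd.ne' h1
  -- With `Q x = (p₁ - p₂) * x ^ 2 - (p₁ + p₂) * x`, this product is `Q D - Q n`, and `Q D = 2`.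
  have h3 : 0 < (D - n) * ((p₁ - p₂) * (D + n) - (p₁ + p₂)) := by
    refine mul_pos (sub_pos.2 hn) ?_
    have : 0 ≤ (p₁ - p₂) * n := by positivity
    linarith
  nlinarith

variable {p γ : Fin 2 → ℝ} {α : ℝ}

/-- Under the assumption on `α`, the ages that may be left idle are below `alternationBound`. -/
lemma exists_admissible (hp₂ : 0 < p 1) (hp : p 1 < p 0) (hp₁ : p 0 < 1)
    (hγ : ∀ k, 0 < γ k) (hγ_sum : γ 0 + γ 1 = 1)
    (hα : 1 / (1 + (alternationBound (p 0) (p 1) - 2) * p 1) < α) (hα₁ : α < 1) :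
    ∃ n₀, Admissible p γ α n₀ ∧
      ∀ n ≤ n₀, whittleIndex (p 0) n < whittleIndex (p 1) (n + 1) := by
  set D := alternationBound (p 0) (p 1) with hD
  have hD2 : 2 < D := by
    have hd := sub_pos.2 hp
    have hs : (p 0 + p 1) / 2 < √(2 * (p 0 - p 1) + (p 0 + p 1) ^ 2 / 4) :=
      Real.lt_sqrt_of_sq_lt (by nlinarith)
    rw [hD, alternationBound, one_div, ← div_eq_inv_mul, lt_div_iff₀ hd]
    by_cases h : p 0 ≤ 3 * p 1
    · linarith
    · have : 2 * (p 0 - p 1) - (p 0 + p 1) / 2 < √(2 * (p 0 - p 1) + (p 0 + p 1) ^ 2 / 4) :=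
        Real.lt_sqrt_of_sq_lt (by push Not at h; nlinarith)
      linarith
  have h1 : 0 < (D - 2) * p 1 := mul_pos (by linarith) hp₂
  have hα0 : 0 < α := lt_trans (by positivity) hα
  have h2 : 1 < α * (1 + (D - 2) * p 1) := by rwa [div_lt_iff₀ (by linarith)] at hα
  -- The assumption on `α` says `1 - α < (D - 2) * p 1 * α`. The ceiling preserves this inequality
  -- and still lies below `D - 1`, hence within the range of alternation.
  refine ⟨⌈D - 2⌉₊, ⟨hp₂, hp, hp₁, hγ, hγ_sum, hα0, hα₁, ?_⟩, fun n hn => ?_⟩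
  · have h3 := Nat.le_ceil (D - 2)
    have h4 := mul_le_mul_of_nonneg_right h3 (mul_pos hp₂ hα0).le
    nlinarith
  · refine whittleIndex_lt_succ hp₂ hp ?_
    have h3 := Nat.ceil_lt_add_one (a := D - 2) (by linarith)
    have h4 : (n : ℝ) ≤ (⌈D - 2⌉₊ : ℝ) := by exact_mod_cast hn
    linarith

end Index

/-! ### Mixtures of neighbouring thresholds -/

section Stationary

variable {p : ℝ}

lemma statDist_denom_pos (hp : 0 < p) (hp1 : p < 1) (l : ℕ) : 0 < l * p + 1 - p := by
  have : 0 ≤ (l : ℝ) * p := by positivity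
  linarith

lemma statDist_of_le {l i : ℕ} (hi : 1 ≤ i) (h : i ≤ l) :
    statDist p l i = p / (l * p + 1 - p) := by
  simp [statDist, h, Nat.one_le_iff_ne_zero.1 hi]

lemma statDist_add {l : ℕ} (hl : 1 ≤ l) (j : ℕ) :
    statDist p l (l + j) = (1 - p) ^ j * (p / (l * p + 1 - p)) := by
  rcases Nat.eq_zero_or_pos j with rfl | hj
  · simp [statDist_of_le hl]
  · simp [statDist, show l ≠ 0 by omega, show j ≠ 0 by omega]

lemma tsum_statDist (hp : 0 < p) (hp1 : p < 1) {l : ℕ} (hl : 1 ≤ l) :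
    ∑' j : ℕ, statDist p l (l + j) = 1 / (l * p + 1 - p) := by
  simp only [statDist_add hl]
  rw [tsum_mul_right, tsum_geometric_of_lt_one (by linarith) (by linarith), sub_sub_cancel,
    ← mul_div_assoc, inv_mul_cancel₀ hp.ne']

/-- The mass of age `i` in a class of mass `γ`, under a mixture of the thresholds `n + 1`
and `n`. -/
noncomputable def mixture (p γ θ : ℝ) (n i : ℕ) : ℝ :=
  γ * (θ * statDist p (n + 1) i + (1 - θ) * statDist p n i)

/-- The scheduled mass of a class of mass `γ`, under a mixture of the thresholds `n + 1`
and `n`. -/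
noncomputable def mixtureRate (p γ θ : ℝ) (n : ℕ) : ℝ :=
  γ * (θ * (1 / ((n + 1 : ℕ) * p + 1 - p)) + (1 - θ) * (1 / (n * p + 1 - p)))

/-- The mass of the users older than `j`, under a mixture of the thresholds `n + 1` and `n`. -/
noncomputable def mixtureTail (p γ θ : ℝ) (n j : ℕ) : ℝ :=
  γ - ∑ i ∈ Finset.range j, mixture p γ θ n (i + 1)

variable {γ θ : ℝ} {n : ℕ}

lemma mixture_of_lt {i : ℕ} (hi : i < n) :
    mixture p γ θ n (i + 1) = p * mixtureRate p γ θ n := by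
  rw [mixture, statDist_of_le (by omega) (by omega), statDist_of_le (by omega) (by omega),
    mixtureRate]
  ring

lemma mixtureTail_of_le {j : ℕ} (hj : j ≤ n) :
    mixtureTail p γ θ n j = γ - j * (p * mixtureRate p γ θ n) := by
  rw [mixtureTail, Finset.sum_congr rfl fun i hi =>
    mixture_of_lt ((Finset.mem_range.1 hi).trans_le hj)]
  simp

/-- Under threshold `n + 1` the users older than `n` are exactly the scheduled ones; under threshold
`n` the scheduled users of age `n` are missing, which leaves the fraction `1 - p`. -/
lemma mixtureTail_self (hp : 0 < p) (hp1 : p < 1) : mixtureTail p γ θ n n =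
    γ * (θ * (1 / ((n + 1 : ℕ) * p + 1 - p)) + (1 - θ) * ((1 - p) / (n * p + 1 - p))) := by
  have h1 := (statDist_denom_pos hp hp1 (n + 1)).ne'
  have h2 := (statDist_denom_pos hp hp1 n).ne'
  have e1 : 1 / ((n + 1 : ℕ) * p + 1 - p) = 1 - n * p * (1 / ((n + 1 : ℕ) * p + 1 - p)) := by
    rw [eq_sub_iff_add_eq, ← one_add_mul, mul_one_div, div_eq_one_iff_eq h1]
    push_cast; ring
  have e2 : (1 - p) / (n * p + 1 - p) = 1 - n * p * (1 / (n * p + 1 - p)) := by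
    rw [eq_sub_iff_add_eq, mul_one_div, ← add_div, div_eq_one_iff_eq h2]
    ring
  rw [mixtureTail_of_le le_rfl, mixtureRate, e2]
  linear_combination (-γ * θ) * e1

lemma mixture_add (hp : 0 < p) (hp1 : p < 1) (hn : 1 ≤ n) (r : ℕ) :
    mixture p γ θ n (n + r + 1) = p * ((1 - p) ^ r * mixtureTail p γ θ n n) := by
  have e1 := statDist_add (p := p) (l := n + 1) (by omega) r
  have e2 := statDist_add (p := p) hn (r + 1)
  rw [show n + 1 + r = n + r + 1 by ring] at e1
  rw [← add_assoc] at e2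
  rw [mixture, e1, e2, mixtureTail_self hp hp1]
  ring

lemma mixtureTail_add (hp : 0 < p) (hp1 : p < 1) (hn : 1 ≤ n) (r : ℕ) :
    mixtureTail p γ θ n (n + r) = (1 - p) ^ r * mixtureTail p γ θ n n := by
  induction r with
  | zero => simp
  | succ r ih =>
    have : mixtureTail p γ θ n (n + (r + 1)) =
        mixtureTail p γ θ n (n + r) - mixture p γ θ n (n + r + 1) := by
      simp only [mixtureTail, ← add_assoc, Finset.sum_range_succ]; ring
    rw [this, ih, mixture_add hp hp1 hn]; ring

lemma mixtureTail_nonneg_self (hp : 0 < p) (hp1 : p < 1) (hγ : 0 ≤ γ) (hθ : 0 ≤ θ)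
    (hθ1 : θ ≤ 1) : 0 ≤ mixtureTail p γ θ n n := by
  have h1 := statDist_denom_pos hp hp1 (n + 1)
  have h2 := statDist_denom_pos hp hp1 n
  have h3 := sub_nonneg.2 hθ1
  have h4 := sub_nonneg.2 hp1.le
  rw [mixtureTail_self hp hp1]
  positivity

lemma mixtureRate_nonneg (hp : 0 < p) (hp1 : p < 1) (hγ : 0 ≤ γ) (hθ : 0 ≤ θ) (hθ1 : θ ≤ 1) :
    0 ≤ mixtureRate p γ θ n := by
  have h1 := statDist_denom_pos hp hp1 (n + 1)
  have h2 := statDist_denom_pos hp hp1 n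
  have h3 := sub_nonneg.2 hθ1
  unfold mixtureRate
  positivity

lemma mixtureTail_self_le (hp : 0 < p) (hp1 : p < 1) (hγ : 0 ≤ γ) (hθ1 : θ ≤ 1) :
    mixtureTail p γ θ n n ≤ mixtureRate p γ θ n := by
  have h2 := statDist_denom_pos hp hp1 n
  rw [mixtureTail_self hp hp1, mixtureRate]
  have h3 := sub_nonneg.2 hθ1
  gcongr
  linarith

lemma mixtureTail_pred (hp : 0 < p) (hp1 : p < 1) (hn : 1 ≤ n) :
    mixtureTail p γ θ n (n - 1) =
      γ * (θ * ((1 + p) / ((n + 1 : ℕ) * p + 1 - p)) + (1 - θ) * (1 / (n * p + 1 - p))) := by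
  have h0 := mixtureTail_of_le (p := p) (γ := γ) (θ := θ) (Nat.sub_le n 1)
  have h1 := mixtureTail_of_le (p := p) (γ := γ) (θ := θ) (le_refl n)
  rw [Nat.cast_sub hn] at h0
  have h2 : mixtureTail p γ θ n (n - 1) = mixtureTail p γ θ n n + p * mixtureRate p γ θ n := by
    rw [h0, h1]; push_cast; ring
  rw [h2, mixtureTail_self hp hp1, mixtureRate]
  ring

lemma le_mixtureTail_pred (hp : 0 < p) (hp1 : p < 1) (hγ : 0 ≤ γ) (hθ : 0 ≤ θ) (hn : 1 ≤ n) :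
    mixtureRate p γ θ n ≤ mixtureTail p γ θ n (n - 1) := by
  have h1 := statDist_denom_pos hp hp1 (n + 1)
  rw [mixtureTail_pred hp hp1 hn, mixtureRate]
  gcongr
  linarith

lemma statDist_nonneg (hp : 0 < p) (hp1 : p < 1) (l i : ℕ) : 0 ≤ statDist p l i := by
  have := statDist_denom_pos hp hp1 l
  have := sub_nonneg.2 hp1.le
  unfold statDist
  split_ifs <;> positivity

lemma mixture_nonneg (hp : 0 < p) (hp1 : p < 1) (hγ : 0 ≤ γ) (hθ : 0 ≤ θ) (hθ1 : θ ≤ 1)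
    (i : ℕ) : 0 ≤ mixture p γ θ n i := by
  have := statDist_nonneg hp hp1 (n + 1) i
  have := statDist_nonneg hp hp1 n i
  have := sub_nonneg.2 hθ1
  unfold mixture
  positivity

lemma mixtureTail_succ (j : ℕ) :
    mixtureTail p γ θ n (j + 1) = mixtureTail p γ θ n j - mixture p γ θ n (j + 1) := by
  rw [mixtureTail, mixtureTail, Finset.sum_range_succ]; ring

lemma mixtureTail_antitone (hp : 0 < p) (hp1 : p < 1) (hγ : 0 ≤ γ) (hθ : 0 ≤ θ) (hθ1 : θ ≤ 1) :
    Antitone (mixtureTail p γ θ n) :=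
  antitone_nat_of_succ_le fun j => by
    rw [mixtureTail_succ]; linarith [mixture_nonneg (n := n) hp hp1 hγ hθ hθ1 (j + 1)]

lemma mixtureTail_nonneg (hp : 0 < p) (hp1 : p < 1) (hγ : 0 ≤ γ) (hθ : 0 ≤ θ) (hθ1 : θ ≤ 1)
    (hn : 1 ≤ n) (j : ℕ) : 0 ≤ mixtureTail p γ θ n j := by
  have h0 := mixtureTail_nonneg_self (n := n) hp hp1 hγ hθ hθ1
  rcases le_total j n with h | h
  · exact h0.trans (mixtureTail_antitone hp hp1 hγ hθ hθ1 h)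
  · obtain ⟨r, rfl⟩ := Nat.exists_eq_add_of_le h
    rw [mixtureTail_add hp hp1 hn]
    exact mul_nonneg (pow_nonneg (by linarith) _) h0

/-- The scheduled mass lies between the tails at `n` and at `n - 1`. So the minimum is the scheduled
mass for `j < n`, where the profile is flat, and the tail for `j ≥ n`, where it is geometric. -/
lemma mixtureTail_dyn (hp : 0 < p) (hp1 : p < 1) (hγ : 0 ≤ γ) (hθ : 0 ≤ θ) (hθ1 : θ ≤ 1)
    (hn : 1 ≤ n) (j : ℕ) : mixtureTail p γ θ n (j + 1) =
      mixtureTail p γ θ n j - p * min (mixtureRate p γ θ n) (mixtureTail p γ θ n j) := by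
  rw [mixtureTail_succ]
  have ha := mixtureTail_antitone (n := n) hp hp1 hγ hθ hθ1
  rcases lt_or_ge j n with h | h
  · rw [mixture_of_lt h, min_eq_left]
    exact (le_mixtureTail_pred hp hp1 hγ hθ hn).trans (ha (by omega))
  · rw [min_eq_right ((ha h).trans (mixtureTail_self_le hp hp1 hγ hθ1))]
    obtain ⟨r, rfl⟩ := Nat.exists_eq_add_of_le h
    rw [mixture_add hp hp1 hn, mixtureTail_add hp hp1 hn]

end Stationary

/-! ### The stationary fluid trajectory -/

section StationaryFluid

variable {p γ : Fin 2 → ℝ} {α : ℝ} {n₀ : ℕ}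

/-- The mixture of neighbouring thresholds that schedules mass `α` is a fluid trajectory. -/
lemma fluid_mixture (H : Admissible p γ α n₀) {θ : Fin 2 → ℝ} {n : ℕ} (hn : 1 ≤ n)
    (hn₀ : n ≤ n₀) (hθ : ∀ k, 0 ≤ θ k) (hθ1 : ∀ k, θ k ≤ 1) (hpair : θ 0 = 0 ∨ θ 1 = 1)
    (hsum : mixtureRate (p 0) (γ 0) (θ 0) n + mixtureRate (p 1) (γ 1) (θ 1) n = α) :
    Fluid p γ α n₀ (fun _ k => mixtureRate (p k) (γ k) (θ k) n)
      (fun _ k => mixtureTail (p k) (γ k) (θ k) n) := by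
  have hanti : ∀ k, Antitone (mixtureTail (p k) (γ k) (θ k) n) := fun k =>
    mixtureTail_antitone (H.p_pos k) (H.p_lt_one k) (H.γ_pos k).le (hθ k) (hθ1 k)
  have hself : ∀ k, mixtureTail (p k) (γ k) (θ k) n n ≤ mixtureRate (p k) (γ k) (θ k) n :=
    fun k => mixtureTail_self_le (H.p_pos k) (H.p_lt_one k) (H.γ_pos k).le (hθ1 k)
  have hpred : ∀ k, mixtureRate (p k) (γ k) (θ k) n ≤ mixtureTail (p k) (γ k) (θ k) n (n - 1) :=
    fun k => le_mixtureTail_pred (H.p_pos k) (H.p_lt_one k) (H.γ_pos k).le (hθ k) hn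
  have hzero : ∀ k, mixtureTail (p k) (γ k) (θ k) n 0 = γ k := fun k => by simp [mixtureTail]
  -- This is where `hpair` enters: either the first class uses threshold `n` exactly, or the second
  -- class uses `n + 1` exactly. Including `j = 0` makes it cover the tie rule too.
  have hsecond : ∀ j, mixtureTail (p 0) (γ 0) (θ 0) n j ≤ mixtureRate (p 0) (γ 0) (θ 0) n ∨
      mixtureRate (p 1) (γ 1) (θ 1) n ≤ mixtureTail (p 1) (γ 1) (θ 1) n (j + 1) := by
    intro j
    rcases hpair with h | h
    · rcases le_or_gt n (j + 1) with hj | hj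
      · left
        refine (hanti 0 (by omega : n - 1 ≤ j)).trans_eq ?_
        rw [mixtureTail_pred (H.p_pos 0) (H.p_lt_one 0) hn, mixtureRate, h]; ring
      · exact Or.inr ((hpred 1).trans (hanti 1 (by omega)))
    · rcases le_or_gt n j with hj | hj
      · exact Or.inl ((hanti 0 hj).trans (hself 0))
      · right
        refine le_trans (le_of_eq ?_) (hanti 1 (by omega : j + 1 ≤ n))
        rw [mixtureTail_self (H.p_pos 1) (H.p_lt_one 1), mixtureRate, h]; ring
  refine ⟨fun _ => ⟨fun k => ?_, fun k => ?_, hsum, hzero, fun k j => hanti k (Nat.le_succ j),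
    fun k j => ?_, fun j _ => ?_, fun j _ => hsecond j, fun _ => ?_⟩,
    fun _ k => (hanti k hn₀).trans (hself k), fun _ k j => ?_⟩
  · exact mixtureRate_nonneg (H.p_pos k) (H.p_lt_one k) (H.γ_pos k).le (hθ k) (hθ1 k)
  · exact (hpred k).trans ((hanti k (Nat.zero_le _)).trans_eq (hzero k))
  · exact mixtureTail_nonneg (H.p_pos k) (H.p_lt_one k) (H.γ_pos k).le (hθ k) (hθ1 k) hn j
  · rcases le_or_gt n j with hj | hj
    · exact Or.inl ((hanti 1 hj).trans (hself 1))
    · exact Or.inr ((hpred 0).trans (hanti 0 (by omega)))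
  · have := hsecond 0
    rwa [hzero] at this
  · exact mixtureTail_dyn (H.p_pos k) (H.p_lt_one k) (H.γ_pos k).le (hθ k) (hθ1 k) hn j

end StationaryFluid

/-! ### Existence and uniqueness of the relaxed optimum -/

section RelaxedOptimum

variable {p γ : Fin 2 → ℝ} {α : ℝ} {n₀ : ℕ}

lemma scheduledMass_eq (hp : ∀ k, 0 < p k) (hp1 : ∀ k, p k < 1) {l : Fin 2 → ℕ}
    (hl : ∀ k, 1 ≤ l k) : scheduledMass p γ l = ∑ k, γ k * (1 / (l k * p k + 1 - p k)) := by
  simp only [scheduledMass, tsum_statDist (hp _) (hp1 _) (hl _)]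

lemma scheduledMass_le (hp : ∀ k, 0 < p k) (hp1 : ∀ k, p k < 1) (hγ : ∀ k, 0 < γ k)
    {l l' : Fin 2 → ℕ} (hl : ∀ k, 1 ≤ l k) (hll : ∀ k, l k ≤ l' k) :
    scheduledMass p γ l' ≤ scheduledMass p γ l := by
  rw [scheduledMass_eq hp hp1 hl, scheduledMass_eq hp hp1 fun k => (hl k).trans (hll k)]
  refine Finset.sum_le_sum fun k _ => ?_
  have h1 := statDist_denom_pos (hp k) (hp1 k) (l k)
  have h2 : (l k : ℝ) ≤ l' k := by exact_mod_cast hll k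
  have h3 := hp k
  have h4 := hγ k
  gcongr

lemma scheduledMass_lt (hp : ∀ k, 0 < p k) (hp1 : ∀ k, p k < 1) (hγ : ∀ k, 0 < γ k)
    {l l' : Fin 2 → ℕ} (hl : ∀ k, 1 ≤ l k) (hll : ∀ k, l k ≤ l' k) {m : Fin 2}
    (hm : l m < l' m) : scheduledMass p γ l' < scheduledMass p γ l := by
  rw [scheduledMass_eq hp hp1 hl, scheduledMass_eq hp hp1 fun k => (hl k).trans (hll k)]
  refine Finset.sum_lt_sum (fun k _ => ?_) ⟨m, Finset.mem_univ _, ?_⟩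
  · have h1 := statDist_denom_pos (hp k) (hp1 k) (l k)
    have h2 : (l k : ℝ) ≤ l' k := by exact_mod_cast hll k
    have h3 := hp k
    have h4 := hγ k
    gcongr
  · have h1 := statDist_denom_pos (hp m) (hp1 m) (l m)
    have h2 : (l m : ℝ) < l' m := by exact_mod_cast hm
    have h3 := hp m
    have h4 := hγ m
    gcongr

lemma one_le_thresholdLow (m : Fin 2) (q : ℕ) (k : Fin 2) : 1 ≤ thresholdLow p m q k :=
  Nat.le_add_left _ _

lemma one_le_thresholdHigh (m : Fin 2) (q : ℕ) (k : Fin 2) : 1 ≤ thresholdHigh p m q k :=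
  Nat.le_add_left _ _

lemma prec_trans {k m m' : Fin 2} {i q q' : ℕ} (h : prec p k i m q) (h' : prec p m q m' q') :
    prec p k i m' q' := by
  unfold prec at *
  rcases h with h | ⟨h, hk⟩ <;> rcases h' with h' | ⟨h', hk'⟩
  · exact Or.inl (h.trans h')
  · exact Or.inl (h.trans_eq h')
  · exact Or.inl (h.trans_lt h')
  · exact Or.inr ⟨h.trans h', hk'.trans hk⟩

lemma prec_self_iff (hp : ∀ k, 0 < p k) {k : Fin 2} {i j : ℕ} : prec p k i k j ↔ i < j := by
  simp [prec, (whittleIndex_strictMono (hp k).le).lt_iff_lt]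

lemma prec_trichotomy (hp : ∀ k, 0 < p k) (m m' : Fin 2) (q q' : ℕ) :
    prec p m q m' q' ∨ (m = m' ∧ q = q') ∨ prec p m' q' m q := by
  unfold prec
  rcases lt_trichotomy (whittleIndex (p m) q) (whittleIndex (p m') q') with h | h | h
  · exact Or.inl (Or.inl h)
  · rcases lt_trichotomy m m' with h' | h' | h'
    · exact Or.inr (Or.inr (Or.inr ⟨h.symm, h'⟩))
    · subst h'
      exact Or.inr (Or.inl ⟨rfl, (whittleIndex_strictMono (hp m).le).injective h⟩)
    · exact Or.inl (Or.inr ⟨h, h'⟩)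
  · exact Or.inr (Or.inr (Or.inl h))

lemma bddAbove_prec (hp : ∀ k, 0 < p k) (m : Fin 2) (q : ℕ) (k : Fin 2) :
    BddAbove {i : ℕ | 1 ≤ i ∧ prec p k i m q} := by
  refine ⟨⌈whittleIndex (p m) q⌉₊, fun i hi => ?_⟩
  have h1 : whittleIndex (p k) i ≤ whittleIndex (p m) q := by
    rcases hi.2 with h | h
    · exact h.le
    · exact h.1.le
  exact Nat.cast_le.1 ((le_whittleIndex (hp k).le i).trans (h1.trans (Nat.le_ceil _)))

lemma thresholdHigh_le_thresholdLow (hp : ∀ k, 0 < p k) {m m' : Fin 2} {q q' : ℕ}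
    (h : prec p m q m' q') (k : Fin 2) : thresholdHigh p m q k ≤ thresholdLow p m' q' k := by
  refine Nat.succ_le_succ ?_
  by_cases hne : {i : ℕ | 1 ≤ i ∧ (prec p k i m q ∨ (k = m ∧ i = q))}.Nonempty
  · refine csSup_le_csSup (bddAbove_prec hp m' q' k) hne ?_
    rintro i ⟨hi, hi' | ⟨rfl, rfl⟩⟩
    · exact ⟨hi, prec_trans hi' h⟩
    · exact ⟨hi, h⟩
  · rw [Set.not_nonempty_iff_eq_empty.1 hne]; simp

lemma sSup_nat_eq {P : ℕ → Prop} {n : ℕ} (hn : 1 ≤ n) (h : ∀ i, 1 ≤ i → (P i ↔ i < n)) :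
    sSup {i : ℕ | 1 ≤ i ∧ P i} + 1 = n := by
  rcases hn.eq_or_lt with rfl | hn'
  · have : {i : ℕ | 1 ≤ i ∧ P i} = ∅ := by
      ext i
      simp only [Set.mem_ofPred_eq, Set.mem_empty_iff_false, iff_false, not_and]
      intro hi hP
      have := (h i hi).1 hP
      omega
    rw [this]; simp
  · have : IsGreatest {i : ℕ | 1 ≤ i ∧ P i} (n - 1) :=
      ⟨⟨by omega, (h _ (by omega)).2 (by omega)⟩, fun i hi => by
        have := (h i hi.1).1 hi.2; omega⟩
    rw [this.csSup_eq]; omega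

lemma thresholdLow_self (hp : ∀ k, 0 < p k) (m : Fin 2) {q : ℕ} (hq : 1 ≤ q) :
    thresholdLow p m q m = q :=
  sSup_nat_eq hq fun _ _ => prec_self_iff hp

lemma thresholdHigh_self (hp : ∀ k, 0 < p k) (m : Fin 2) (q : ℕ) :
    thresholdHigh p m q m = q + 1 := by
  refine sSup_nat_eq (by omega) fun i _ => ?_
  rw [prec_self_iff hp]
  simp only [true_and]
  omega

lemma thresholdHigh_of_ne {m k : Fin 2} (q : ℕ) (h : k ≠ m) :
    thresholdHigh p m q k = thresholdLow p m q k := by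
  simp [thresholdHigh, thresholdLow, h]

lemma thresholdLow_le_thresholdHigh (hp : ∀ k, 0 < p k) (m k : Fin 2) {q : ℕ} (hq : 1 ≤ q) :
    thresholdLow p m q k ≤ thresholdHigh p m q k := by
  by_cases h : k = m
  · subst h
    rw [thresholdLow_self hp k hq, thresholdHigh_self hp k q]; omega
  · rw [thresholdHigh_of_ne q h]

/-- The relaxed optimum is unique. -/
lemma IsRelaxedOptimum.unique (hp : ∀ k, 0 < p k) (hp1 : ∀ k, p k < 1) (hγ : ∀ k, 0 < γ k)
    {z z' : Fin 2 → ℕ → ℝ} (h : IsRelaxedOptimum p γ α z) (h' : IsRelaxedOptimum p γ α z') :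
    z = z' := by
  have hlt : ∀ (m : Fin 2) (q : ℕ), 1 ≤ q →
      scheduledMass p γ (thresholdHigh p m q) < scheduledMass p γ (thresholdLow p m q) :=
    fun m q hq => scheduledMass_lt hp hp1 hγ (one_le_thresholdLow m q)
      (fun k => thresholdLow_le_thresholdHigh hp m k hq) (m := m) (by
        rw [thresholdLow_self hp m hq, thresholdHigh_self hp m q]; omega)
  -- Since `0 < θ ≤ 1`, `α` lies in the half-open interval from the mass at the high thresholds
  -- (included) to the mass at the low thresholds (excluded). Along the priority order these
  -- intervals are disjoint.
  have hsep : ∀ (m m' : Fin 2) (q q' : ℕ) (θ θ' : ℝ), 1 ≤ q → 1 ≤ q' → θ ≤ 1 → 0 < θ' →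
      θ * scheduledMass p γ (thresholdHigh p m q) +
        (1 - θ) * scheduledMass p γ (thresholdLow p m q) = α →
      θ' * scheduledMass p γ (thresholdHigh p m' q') +
        (1 - θ') * scheduledMass p γ (thresholdLow p m' q') = α → ¬ prec p m q m' q' := by
    intro m m' q q' θ θ' hq hq' hθ hθ' e e' hprec
    have h1 : scheduledMass p γ (thresholdLow p m' q') ≤ scheduledMass p γ (thresholdHigh p m q) :=
      scheduledMass_le hp hp1 hγ (one_le_thresholdHigh m q)
        (thresholdHigh_le_thresholdLow hp hprec)
    have h2 := mul_pos hθ' (sub_pos.2 (hlt m' q' hq'))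
    have h3 := mul_nonneg (sub_nonneg.2 hθ) (sub_pos.2 (hlt m q hq)).le
    linarith
  obtain ⟨m, q, θ, hq, hθ, hθ1, e, hz⟩ := h
  obtain ⟨m', q', θ', hq', hθ', hθ1', e', hz'⟩ := h'
  rcases prec_trichotomy hp m m' q q' with h | ⟨rfl, rfl⟩ | h
  · exact absurd h (hsep m m' q q' θ θ' hq hq' hθ1 hθ' e e')
  · have h1 : θ = θ' := by
      have h2 := sub_pos.2 (hlt m q hq)
      have h3 : (θ - θ') * (scheduledMass p γ (thresholdLow p m q) -
          scheduledMass p γ (thresholdHigh p m q)) = 0 := by linarith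
      rcases mul_eq_zero.1 h3 with h | h <;> linarith
    funext k i
    rw [hz, hz', h1]
  · exact absurd h (hsep m' m q' q θ' θ hq' hq hθ1' hθ e' e)

lemma exists_mixing {x y α : ℝ} (hx : x ≤ α) (hy : α < y) :
    ∃ θ, 0 < θ ∧ θ ≤ 1 ∧ θ * x + (1 - θ) * y = α := by
  have h : 0 < y - x := by linarith
  refine ⟨(y - α) / (y - x), div_pos (by linarith) h, (div_le_one h).2 (by linarith), ?_⟩
  field_simp
  ring

/-- The relaxed optimum exists, and it mixes neighbouring thresholds. -/
lemma exists_isRelaxedOptimum (H : Admissible p γ α n₀)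
    (halt : ∀ n ≤ n₀, whittleIndex (p 0) n < whittleIndex (p 1) (n + 1)) :
    ∃ (θ : Fin 2 → ℝ) (n : ℕ), 1 ≤ n ∧ n ≤ n₀ ∧ (∀ k, 0 ≤ θ k) ∧ (∀ k, θ k ≤ 1) ∧
      (θ 0 = 0 ∨ θ 1 = 1) ∧
      mixtureRate (p 0) (γ 0) (θ 0) n + mixtureRate (p 1) (γ 1) (θ 1) n = α ∧
      IsRelaxedOptimum p γ α fun k i => mixture (p k) (γ k) (θ k) n i := by
  classical
  have hp := H.p_pos
  have hp1 := H.p_lt_one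
  have hmono := fun k => whittleIndex_strictMono (hp k).le
  have hn₀ : scheduledMass p γ (fun _ => n₀ + 1) ≤ α := by
    rw [scheduledMass_eq hp hp1 fun _ => Nat.le_add_left _ _]
    have h1 : ∀ k, 1 / (((n₀ + 1 : ℕ) : ℝ) * p k + 1 - p k) ≤ α := by
      intro k
      have h2 : p 1 ≤ p k := by fin_cases k <;> simp [H.lt.le]
      have h3 := mul_le_mul_of_nonneg_left h2 (mul_nonneg (Nat.cast_nonneg n₀) H.α_pos.le)
      have h4 := H.arrivals
      rw [div_le_iff₀ (statDist_denom_pos (hp k) (hp1 k) _)]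
      push_cast
      nlinarith
    calc ∑ k, γ k * (1 / (((n₀ + 1 : ℕ) : ℝ) * p k + 1 - p k)) ≤ ∑ k, γ k * α :=
          Finset.sum_le_sum fun k _ => mul_le_mul_of_nonneg_left (h1 k) (H.γ_pos k).le
      _ = α := by rw [← Finset.sum_mul, Fin.sum_univ_two, H.γ_sum, one_mul]
  have hex : ∃ n : ℕ, scheduledMass p γ (fun _ => n + 1) ≤ α := ⟨n₀, hn₀⟩
  obtain ⟨n, hn1, hn, hmin, hle⟩ : ∃ n, 1 ≤ n ∧ scheduledMass p γ (fun _ => n + 1) ≤ α ∧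
      α < scheduledMass p γ (fun _ => n) ∧ n ≤ n₀ := by
    have h0 : Nat.find hex ≠ 0 := by
      intro h
      have := Nat.find_spec hex
      rw [h, scheduledMass_eq hp hp1 fun _ => Nat.le_add_left _ _, Fin.sum_univ_two] at this
      simp only [zero_add, Nat.cast_one, one_mul, add_sub_cancel_left, div_one, mul_one,
        H.γ_sum] at this
      exact absurd H.α_lt (not_lt.2 this)
    have h1 : ¬ _ := Nat.find_min hex (m := Nat.find hex - 1) (by omega)
    rw [Nat.sub_add_cancel (by omega), not_le] at h1
    refine ⟨Nat.find hex, by omega, Nat.find_spec hex, h1, Nat.find_min' hex hn₀⟩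
  -- By alternation, the threshold vectors around age `n` are successively `(n, n)`, `(n, n + 1)`
  -- and `(n + 1, n + 1)`: crossing the pair of the second class and age `n` gives the first step,
  -- crossing that of the first class and age `n` the second.
  have hlow0 : thresholdLow p 0 n 1 = n + 1 := by
    refine sSup_nat_eq (by omega) fun i _ => ?_
    simp only [prec, zero_lt_one, and_true,
      ← le_iff_lt_or_eq]
    constructor
    · intro h
      exact (hmono 1).lt_iff_lt.1 (h.trans_lt (halt n hle))
    · intro h
      exact ((hmono 1).monotone (by omega : i ≤ n)).trans (whittleIndex_le_of_le H.lt.le n)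
  have hlow1 : thresholdLow p 1 n 0 = n := by
    refine sSup_nat_eq hn1 fun i hi => ?_
    simp only [prec, not_lt_zero, and_false, or_false]
    constructor
    · intro h
      by_contra! h1
      exact absurd h (not_lt.2 ((whittleIndex_le_of_le H.lt.le n).trans ((hmono 0).monotone h1)))
    · intro h
      exact (halt i (by omega)).trans_le ((hmono 1).monotone h)
  have e00 := thresholdLow_self hp 0 hn1
  have e11 := thresholdLow_self hp 1 hn1
  have f00 := thresholdHigh_self hp 0 n
  have f11 := thresholdHigh_self hp 1 n
  have f01 := (thresholdHigh_of_ne (p := p) (m := 0) (k := 1) n (by simp)).trans hlow0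
  have f10 := (thresholdHigh_of_ne (p := p) (m := 1) (k := 0) n (by simp)).trans hlow1
  have sLow0 : thresholdLow p 0 n = ![n, n + 1] := by ext k; fin_cases k <;> simp [e00, hlow0]
  have sHigh0 : thresholdHigh p 0 n = fun _ => n + 1 := by
    ext k; fin_cases k <;> simp [f00, f01]
  have sLow1 : thresholdLow p 1 n = fun _ => n := by ext k; fin_cases k <;> simp [e11, hlow1]
  have sHigh1 : thresholdHigh p 1 n = ![n, n + 1] := by ext k; fin_cases k <;> simp [f10, f11]
  have hpos : ∀ k, 1 ≤ (![n, n + 1] : Fin 2 → ℕ) k := by intro k; fin_cases k <;> simp [hn1]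
  have mMid : scheduledMass p γ ![n, n + 1] = γ 0 * (1 / (n * p 0 + 1 - p 0)) +
      γ 1 * (1 / ((n + 1 : ℕ) * p 1 + 1 - p 1)) := by
    rw [scheduledMass_eq hp hp1 hpos, Fin.sum_univ_two]; simp
  have mHigh := scheduledMass_eq (γ := γ) hp hp1 (l := fun _ => n + 1) fun _ => Nat.le_add_left _ _
  have mLow := scheduledMass_eq (γ := γ) hp hp1 (l := fun _ => n) fun _ => hn1
  rw [Fin.sum_univ_two] at mHigh mLow
  -- The mass at `(n, n + 1)` decides which class mixes; the other one has a pure threshold.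
  by_cases hmid : scheduledMass p γ ![n, n + 1] ≤ α
  · obtain ⟨θ, hθ, hθ1, e⟩ := exists_mixing hmid hmin
    refine ⟨![0, θ], n, hn1, hle, ?_, ?_, Or.inl rfl, ?_, 1, n, θ, hn1, hθ, hθ1, ?_, ?_⟩
    · intro k; fin_cases k <;> simp [hθ.le]
    · intro k; fin_cases k <;> simp [hθ1]
    · rw [mMid, mLow] at e
      simp only [mixtureRate, Matrix.cons_val_zero, Matrix.cons_val_one]
      linarith
    · rw [sHigh1, sLow1]; exact e
    · intro k i
      rw [sHigh1, sLow1]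
      fin_cases k <;> simp [mixture] <;> ring_nf <;> simp
  · obtain ⟨θ, hθ, hθ1, e⟩ := exists_mixing hn (not_le.1 hmid)
    refine ⟨![θ, 1], n, hn1, hle, ?_, ?_, Or.inr rfl, ?_, 0, n, θ, hn1, hθ, hθ1, ?_, ?_⟩
    · intro k; fin_cases k <;> simp [hθ.le]
    · intro k; fin_cases k <;> simp [hθ1]
    · rw [mMid, mHigh] at e
      simp only [mixtureRate, Matrix.cons_val_zero, Matrix.cons_val_one]
      linarith
    · rw [sHigh0, sLow0]; exact e
    · intro k i
      rw [sHigh0, sLow0]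
      fin_cases k <;> simp [mixture] <;> ring_nf <;> simp

end RelaxedOptimum

end WhittleAoI

namespace WhittleAoI

/-! ### Control of the weighted norm -/

/-- A vector that is small on young ages and has a geometric tail, up to a small error on
finitely many ages, has a small weighted norm. -/
lemma exists_weightedNorm_le {C r μ : ℝ} (hC : 0 ≤ C) (hr : 0 < r) (hr1 : r < 1) (hμ : 0 < μ) :
    ∃ (K : ℕ) (δ : ℝ), 0 < δ ∧ ∀ R : ℕ, ∃ η : ℝ, 0 < η ∧ ∀ v : Fin 2 → ℕ → ℝ,
      (∀ k, ∀ i ≤ K, |v k i| ≤ δ) →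
      (∀ k i, |v k i| ≤ C * r ^ i + if i ≤ R then η else 0) →
      weightedNorm v ≤ ENNReal.ofReal μ := by
  have hsum : Summable fun i : ℕ => C * r ^ i * i := by
    have := (summable_pow_mul_geometric_of_norm_lt_one 1
      (show ‖r‖ < 1 by rwa [Real.norm_of_nonneg hr.le])).mul_left C
    refine this.congr fun i => ?_
    rw [pow_one]; ring
  have h6 : 0 < μ / 6 := by positivity
  obtain ⟨K, hK⟩ := Filter.eventually_atTop.1
    ((tendsto_sum_nat_add fun i : ℕ => C * r ^ i * i).eventually_lt_const h6)
  have hK := (hK (K + 1) (Nat.le_succ K)).le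
  -- Each of the two classes contributes three errors of at most `μ / 6`: ages up to `K`, the
  -- geometric tail beyond, and the perturbation `η`. `K` and `δ` are fixed before `R`, because the
  -- waiting time depends on them while `R` grows with the time window.
  refine ⟨K, μ / 6 / (K + 1) ^ 2, by positivity, fun R =>
    ⟨μ / 6 / (R + 1) ^ 2, by positivity, fun v hv hv' => ?_⟩⟩
  have hsmall : ∀ n : ℕ, ((n + 1 : ℕ) : ℝ≥0∞) * ENNReal.ofReal (μ / 6 / (n + 1) ^ 2 * n) ≤
      ENNReal.ofReal (μ / 6) := by
    intro n
    rw [← ENNReal.ofReal_natCast, ← ENNReal.ofReal_mul (Nat.cast_nonneg _)]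
    refine ENNReal.ofReal_le_ofReal ?_
    have hn : (0 : ℝ) < n + 1 := by positivity
    have e : ((n + 1 : ℕ) : ℝ) * (μ / 6 / (n + 1) ^ 2 * n) = μ / 6 * (n / (n + 1)) := by
      push_cast; field_simp
    rw [e]
    exact mul_le_of_le_one_right h6.le ((div_le_one hn).2 (by linarith))
  have key : ∀ k, ∑' i : ℕ, ENNReal.ofReal (|v k i| * i) ≤
      ENNReal.ofReal (μ / 6) + (ENNReal.ofReal (μ / 6) + ENNReal.ofReal (μ / 6)) := by
    intro k
    rw [← Summable.sum_add_tsum_nat_add' (k := K + 1) ENNReal.summable]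
    refine add_le_add ?_ ?_
    · calc ∑ i ∈ Finset.range (K + 1), ENNReal.ofReal (|v k i| * i)
          ≤ ∑ i ∈ Finset.range (K + 1), ENNReal.ofReal (μ / 6 / (K + 1) ^ 2 * K) := by
            refine Finset.sum_le_sum fun i hi => ENNReal.ofReal_le_ofReal ?_
            have hi : i ≤ K := Nat.lt_succ_iff.1 (Finset.mem_range.1 hi)
            have := hv k i hi
            have : (i : ℝ) ≤ K := by exact_mod_cast hi
            gcongr
        _ ≤ _ := by simpa [Finset.sum_const] using hsmall K
    · calc ∑' i : ℕ, ENNReal.ofReal (|v k (i + (K + 1))| * (i + (K + 1) : ℕ))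
          ≤ ∑' i : ℕ, (ENNReal.ofReal (C * r ^ (i + (K + 1)) * (i + (K + 1) : ℕ)) +
              if i ∈ Finset.range (R + 1) then ENNReal.ofReal (μ / 6 / (R + 1) ^ 2 * R) else 0) := by
            refine ENNReal.tsum_le_tsum fun i => ?_
            set m := i + (K + 1)
            have h1 := mul_le_mul_of_nonneg_right (hv' k m) (Nat.cast_nonneg (α := ℝ) m)
            by_cases hm : m ≤ R
            · have hi : i ∈ Finset.range (R + 1) := Finset.mem_range.2 (by omega)
              rw [if_pos hm, add_mul] at h1
              rw [if_pos hi, ← ENNReal.ofReal_add (by positivity) (by positivity)]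
              refine ENNReal.ofReal_le_ofReal (h1.trans ?_)
              have : (m : ℝ) ≤ R := by exact_mod_cast hm
              gcongr
            · rw [if_neg hm, add_zero] at h1
              exact (ENNReal.ofReal_le_ofReal h1).trans le_self_add
        _ ≤ _ := by
            rw [ENNReal.tsum_add, ← ENNReal.ofReal_tsum_of_nonneg (fun i => by positivity)
              ((summable_nat_add_iff (K + 1)).2 hsum)]
            refine add_le_add (ENNReal.ofReal_le_ofReal hK) ?_
            rw [tsum_eq_sum (s := Finset.range (R + 1)) (fun i hi => if_neg hi),
              Finset.sum_congr rfl fun i hi => if_pos hi]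
            simpa [Finset.sum_const] using hsmall R
  calc weightedNorm v ≤ ∑ _k : Fin 2,
        (ENNReal.ofReal (μ / 6) + (ENNReal.ofReal (μ / 6) + ENNReal.ofReal (μ / 6))) :=
        Finset.sum_le_sum fun k _ => key k
    _ = ENNReal.ofReal μ := by
        rw [Fin.sum_univ_two, ← ENNReal.ofReal_add h6.le h6.le,
          ← ENNReal.ofReal_add h6.le (by positivity), ← ENNReal.ofReal_add (by positivity)
          (by positivity)]
        congr 1; ring

/-! ### Finite systems as perturbed fluid trajectories -/

namespace WhittleSystem

variable {p γ : Fin 2 → ℝ} {α : ℝ} {n₀ N M : ℕ} {Ω : Type*} [MeasurableSpace Ω] {P : Measure Ω}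
  (S : WhittleSystem p N M P)

/-- Proportion of the users of class `k` that are older than `n`. -/
noncomputable def older (t : ℕ) (ω : Ω) (k : Fin 2) (n : ℕ) : ℝ :=
  ((Finset.univ.filter fun j : Fin N => S.cls j = k ∧ n < S.age t ω j).card : ℝ) / N

/-- Proportion of the users that are of class `k` and scheduled. -/
noncomputable def rate (t : ℕ) (ω : Ω) (k : Fin 2) : ℝ :=
  (((S.sched t ω).filter fun j => S.cls j = k).card : ℝ) / N

/-- The scheduled users of class `k` that are older than `n`. -/
def schedOlder (t : ℕ) (ω : Ω) (k : Fin 2) (n : ℕ) : Finset (Fin N) :=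
  (S.sched t ω).filter fun j => S.cls j = k ∧ n < S.age t ω j

/-- In each of the first `T` slots the numbers of successes are within `ε N` of their means. -/
def NoiseLE (ω : Ω) (ε : ℝ) (T : ℕ) : Prop :=
  ∀ t < T, ∀ k n, |(((S.schedOlder t ω k n).filter fun j => S.chan t ω j = true).card : ℝ) / N -
    p k * (((S.schedOlder t ω k n).card : ℝ) / N)| ≤ ε

lemma age_zero (ω : Ω) (j : Fin N) : S.age 0 ω j = S.init ω j := rfl

lemma age_succ (t : ℕ) (ω : Ω) (j : Fin N) : S.age (t + 1) ω j =
    if j ∈ S.sched t ω ∧ S.chan t ω j = true then 1 else S.age t ω j + 1 := rfl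

lemma one_le_age (t : ℕ) (ω : Ω) (j : Fin N) : 1 ≤ S.age t ω j := by
  cases t with
  | zero => exact S.init_pos ω j
  | succ t => rw [S.age_succ]; split_ifs <;> omega

lemma age_le {ω : Ω} {I : ℕ} (h : ∀ j, S.init ω j ≤ I) (t : ℕ) (j : Fin N) :
    S.age t ω j ≤ I + t := by
  induction t with
  | zero => exact h j
  | succ t ih => rw [S.age_succ]; split_ifs <;> omega

lemma older_succ_succ (t : ℕ) (ω : Ω) (k : Fin 2) (n : ℕ) :
    S.older (t + 1) ω k (n + 1) = S.older t ω k n -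
      (((S.schedOlder t ω k n).filter fun j => S.chan t ω j = true).card : ℝ) / N := by
  rw [older, older, ← sub_div]
  congr 1
  rw [eq_sub_iff_add_eq]
  norm_cast
  rw [← Finset.card_union_of_disjoint]
  · congr 1
    ext j
    simp only [schedOlder, Finset.mem_union, Finset.mem_filter, Finset.mem_univ, true_and]
    rw [S.age_succ]
    by_cases h : j ∈ S.sched t ω ∧ S.chan t ω j = true
    · simp [h]
    · simp only [h, if_false, add_lt_add_iff_right, or_iff_left_iff_imp]
      exact fun h' => h'.1.2
  · refine Finset.disjoint_left.2 fun j hj hj' => ?_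
    simp only [schedOlder, Finset.mem_filter] at hj hj'
    have := hj.2.2
    rw [S.age_succ, if_pos ⟨hj'.1.1, hj'.2⟩] at this
    omega

lemma older_antitone (t : ℕ) (ω : Ω) (k : Fin 2) : Antitone (S.older t ω k) := by
  intro m n h
  unfold older
  gcongr

lemma older_nonneg (t : ℕ) (ω : Ω) (k : Fin 2) (n : ℕ) : 0 ≤ S.older t ω k n := by
  unfold older; positivity

lemma rate_nonneg (t : ℕ) (ω : Ω) (k : Fin 2) : 0 ≤ S.rate t ω k := by
  unfold rate; positivity

lemma older_eq_zero {ω : Ω} {I : ℕ} (h : ∀ j, S.init ω j ≤ I) {t n : ℕ} (hn : I + t ≤ n)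
    (k : Fin 2) : S.older t ω k n = 0 := by
  rw [older, Finset.filter_false_of_mem]
  · simp
  · intro j _ hj
    have := S.age_le h t j
    omega

lemma Z_zero (t : ℕ) (ω : Ω) (k : Fin 2) : S.Z t ω k 0 = 0 := by
  rw [Z, Finset.filter_false_of_mem]
  · simp
  · intro j _ hj
    have := S.one_le_age t ω j
    omega

lemma Z_succ (t : ℕ) (ω : Ω) (k : Fin 2) (n : ℕ) :
    S.Z t ω k (n + 1) = S.older t ω k n - S.older t ω k (n + 1) := by
  rw [Z, older, older, ← sub_div]
  congr 1
  rw [eq_sub_iff_add_eq]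
  norm_cast
  rw [← Finset.card_union_of_disjoint]
  · congr 1
    ext j
    simp only [Finset.mem_union, Finset.mem_filter, Finset.mem_univ, true_and]
    rw [← and_or_left]
    refine and_congr_right fun _ => ?_
    omega
  · refine Finset.disjoint_left.2 fun j hj hj' => ?_
    simp only [Finset.mem_filter] at hj hj'
    omega

lemma older_le_rate_or (t : ℕ) (ω : Ω) (k : Fin 2) (n : ℕ) :
    S.older t ω k n ≤ S.rate t ω k ∨ ∃ j ∉ S.sched t ω, S.cls j = k ∧ n < S.age t ω j := by
  by_contra! h
  refine absurd h.1 (not_lt.2 ?_)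
  unfold older rate
  gcongr
  intro j hj
  simp only [Finset.mem_filter, Finset.mem_univ, true_and] at hj ⊢
  refine ⟨?_, hj.1⟩
  by_contra hs
  exact absurd hj.2 (not_lt.2 (h.2 j hs hj.1))

lemma rate_le_older_or (t : ℕ) (ω : Ω) (k : Fin 2) (n : ℕ) :
    S.rate t ω k ≤ S.older t ω k n ∨ ∃ i ∈ S.sched t ω, S.cls i = k ∧ S.age t ω i ≤ n := by
  by_contra! h
  refine absurd h.1 (not_lt.2 ?_)
  unfold older rate
  gcongr
  intro j hj
  simp only [Finset.mem_filter, Finset.mem_univ, true_and] at hj ⊢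
  exact ⟨hj.2, h.2 j hj.1 hj.2⟩

lemma not_lt_whittleIndex {t : ℕ} {ω : Ω} {i j : Fin N} (hi : i ∈ S.sched t ω)
    (hj : j ∉ S.sched t ω) : ¬ whittleIndex (p (S.cls i)) (S.age t ω i) <
      whittleIndex (p (S.cls j)) (S.age t ω j) :=
  not_lt.2 (S.sched_whittle t ω i hi j hj)

/-- Within a class the index increases strictly with age, so the oldest users are served first:
either only users older than `n` are served, or all of them are. -/
lemma card_schedOlder_div (hp : ∀ k, 0 < p k) (t : ℕ) (ω : Ω) (k : Fin 2) (n : ℕ) :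
    ((S.schedOlder t ω k n).card : ℝ) / N = min (S.rate t ω k) (S.older t ω k n) := by
  have h1 : ((S.schedOlder t ω k n).card : ℝ) / N ≤ S.rate t ω k := by
    unfold rate schedOlder; gcongr; tauto
  have h2 : ((S.schedOlder t ω k n).card : ℝ) / N ≤ S.older t ω k n := by
    unfold older schedOlder; gcongr; exact Finset.subset_univ _
  refine le_antisymm (le_min h1 h2) ?_
  have key : (∀ i ∈ S.sched t ω, S.cls i = k → n < S.age t ω i) ∨
      ∀ j ∉ S.sched t ω, S.cls j = k → S.age t ω j ≤ n := by
    by_contra! h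
    obtain ⟨⟨i, hi, hik, hin⟩, j, hj, hjk, hjn⟩ := h
    refine S.not_lt_whittleIndex hi hj ?_
    rw [hik, hjk]
    exact whittleIndex_strictMono (hp k).le (hin.trans_lt hjn)
  rcases key with h | h
  · refine (min_le_left _ _).trans ?_
    unfold rate schedOlder
    gcongr with j hj
    exact fun hk => ⟨hk, h j hj hk⟩
  · refine (min_le_right _ _).trans ?_
    have hsub : (Finset.univ.filter fun j : Fin N => S.cls j = k ∧ n < S.age t ω j) ⊆
        (S.sched t ω).filter fun j => S.cls j = k ∧ n < S.age t ω j := by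
      intro j hj
      rw [Finset.mem_filter] at hj ⊢
      refine ⟨?_, hj.2⟩
      by_contra hs
      exact absurd hj.2.2 (not_lt.2 (h j hs hj.2.1))
    unfold older schedOlder
    gcongr

/-- The assumptions of the theorem on a system of finite size. -/
structure IsRegular (S : WhittleSystem p N M P) (γ : Fin 2 → ℝ) (α : ℝ) : Prop where
  pos : 0 < N
  card_sched : (M : ℝ) = α * N
  card_cls : ∀ k, ((Finset.univ.filter fun j : Fin N => S.cls j = k).card : ℝ) = γ k * N
  first : γ 0 / (1 + p 0) + γ 1 / (1 + p 1) < α → S.FirstClassFirstAtAgeOne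

/-- The comparisons hold exactly, for every outcome and every tie-breaking. A failure would exhibit
a scheduled user outranked by an idle one, or violate the tie rule at age 1. -/
lemma allocation (R : S.IsRegular γ α) (H : Admissible p γ α n₀)
    (halt : ∀ n ≤ n₀, whittleIndex (p 0) n < whittleIndex (p 1) (n + 1)) (t : ℕ) (ω : Ω) :
    Allocation p γ α n₀ (S.rate t ω) (S.older t ω) := by
  have hN : (N : ℝ) ≠ 0 := by exact_mod_cast R.pos.ne'
  have hmono := fun k => whittleIndex_strictMono (H.p_pos k).le
  refine ⟨S.rate_nonneg t ω, fun k => ?_, ?_, fun k => ?_,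
    fun k n => S.older_antitone t ω k n.le_succ, S.older_nonneg t ω, fun n hn => ?_,
    fun n hn => ?_, fun hα => ?_⟩
  · rw [rate, div_le_iff₀ (by exact_mod_cast R.pos), ← R.card_cls]
    norm_cast
    exact Finset.card_le_card (Finset.filter_subset_filter _ (Finset.subset_univ _))
  · rw [rate, rate, ← add_div, div_eq_iff hN, ← R.card_sched]
    norm_cast
    refine Eq.trans ?_ (S.sched_card t ω)
    rw [← Finset.card_filter_add_card_filter_not (s := S.sched t ω) fun j => S.cls j = 0]
    congr 2
    refine Finset.filter_congr fun j _ => ?_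
    generalize S.cls j = k
    fin_cases k <;> simp
  · rw [older, div_eq_iff hN, ← R.card_cls]
    congr 2
    refine Finset.filter_congr fun j _ => ?_
    exact and_iff_left (S.one_le_age t ω j)
  · rcases S.older_le_rate_or t ω 1 n with h | ⟨j, hj, hj1, hjn⟩
    · exact Or.inl h
    rcases S.rate_le_older_or t ω 0 n with h | ⟨i, hi, hi0, hin⟩
    · exact Or.inr h
    refine absurd ?_ (S.not_lt_whittleIndex hi hj)
    rw [hi0, hj1]
    exact ((hmono 0).monotone hin).trans_lt ((halt n hn).trans_le ((hmono 1).monotone hjn))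
  · rcases S.older_le_rate_or t ω 0 n with h | ⟨j, hj, hj0, hjn⟩
    · exact Or.inl h
    rcases S.rate_le_older_or t ω 1 (n + 1) with h | ⟨i, hi, hi1, hin⟩
    · exact Or.inr h
    refine absurd ?_ (S.not_lt_whittleIndex hi hj)
    rw [hi1, hj0]
    exact ((hmono 1).monotone hin).trans_lt
      ((whittleIndex_lt_of_lt H.lt (by omega)).trans_le ((hmono 0).monotone hjn))
  · rcases S.older_le_rate_or t ω 0 0 with h | ⟨j, hj, hj0, -⟩
    · left
      refine le_trans (le_of_eq ?_) h
      rw [older, eq_comm, div_eq_iff hN, ← R.card_cls]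
      congr 2
      exact Finset.filter_congr fun j _ => and_iff_left (S.one_le_age t ω j)
    rcases S.rate_le_older_or t ω 1 1 with h | ⟨i, hi, hi1, hin⟩
    · exact Or.inr h
    exfalso
    have hi' : S.age t ω i = 1 := le_antisymm hin (S.one_le_age t ω i)
    refine R.first hα t ω i hi j hj hi' ?_ ⟨hi1, hj0⟩
    refine le_antisymm ?_ (S.one_le_age t ω j)
    by_contra! h
    refine S.not_lt_whittleIndex hi hj ?_
    rw [hi', whittleIndex_one, ← whittleIndex_one (p (S.cls j))]
    exact (hmono _) h

variable {S}

lemma NoiseLE.dyn {ω : Ω} {ε : ℝ} {T : ℕ} (hn : S.NoiseLE ω ε T) (hp : ∀ k, 0 < p k) {t : ℕ}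
    (ht : t < T) (k : Fin 2) (n : ℕ) : |S.older (t + 1) ω k (n + 1) -
      (S.older t ω k n - p k * min (S.rate t ω k) (S.older t ω k n))| ≤ ε := by
  have h := hn t ht k n
  rw [S.card_schedOlder_div hp, abs_sub_comm] at h
  rw [S.older_succ_succ]
  convert h using 2
  ring

end WhittleSystem

lemma Allocation.rate_le {p γ : Fin 2 → ℝ} {α : ℝ} {n₀ : ℕ} {a : Fin 2 → ℝ} {g : Fin 2 → ℕ → ℝ}
    (A : Allocation p γ α n₀ a g) {n : ℕ} (hn : n ≤ n₀) (h : α < g 0 n + g 1 n) (k : Fin 2) :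
    a k ≤ g k n := by
  have hs := A.sum
  rcases Nat.eq_zero_or_pos n with rfl | hn'
  · rw [A.g_zero]; exact A.le_γ k
  have h0 : a 0 ≤ g 0 n := by
    rcases A.first_first n hn with h' | h' <;> linarith
  have h1 : a 1 ≤ g 1 n := by
    rcases A.second_first n hn' with h' | h'
    · linarith
    · exact h'.trans (A.g_succ_le 1 n)
  fin_cases k
  · exact h0
  · exact h1

lemma Allocation.lt_of_lt {p γ : Fin 2 → ℝ} {α : ℝ} {n₀ : ℕ} {a : Fin 2 → ℝ} {g : Fin 2 → ℕ → ℝ}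
    (A : Allocation p γ α n₀ a g) {n : ℕ} (hn : n ≤ n₀) (hn' : 1 ≤ n) {k : Fin 2}
    (h : a k < g k n) : α < g 0 n + g 1 n := by
  have hs := A.sum
  fin_cases k
  · have h : a 0 < g 0 n := h
    have := ((A.second_first n hn').resolve_left (not_le.2 h)).trans (A.g_succ_le 1 n)
    linarith
  · have h : a 1 < g 1 n := h
    have := (A.first_first n hn).resolve_left (not_le.2 h)
    linarith

namespace WhittleSystem

variable {p γ : Fin 2 → ℝ} {α : ℝ} {n₀ N M : ℕ} {Ω : Type*} [MeasurableSpace Ω] {P : Measure Ω}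
  {S : WhittleSystem p N M P}

/-- After `n₀` slots, all users older than `n₀` are scheduled. -/
lemma older_le_rate (R : S.IsRegular γ α) (H : Admissible p γ α n₀)
    (halt : ∀ n ≤ n₀, whittleIndex (p 0) n < whittleIndex (p 1) (n + 1)) {ω : Ω} {ε : ℝ} {T : ℕ}
    (hnoise : S.NoiseLE ω ε T) (hε : 1 - α < n₀ * (p 1 * α - 2 * ε)) {t : ℕ} (ht : n₀ ≤ t)
    (htT : t ≤ T) (k : Fin 2) : S.older t ω k n₀ ≤ S.rate t ω k := by
  by_contra! hlt
  obtain ⟨τ, rfl⟩ := Nat.exists_eq_add_of_le' ht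
  have A := S.allocation R H halt
  have hlast := (A (τ + n₀) ω).lt_of_lt le_rfl (Fluid.one_le H) hlt
  have hstep : ∀ r k, S.older (τ + (r + 1)) ω k (r + 1) ≤ S.older (τ + r) ω k r := by
    intro r k
    rw [← add_assoc, S.older_succ_succ]
    exact sub_le_self _ (by positivity)
  have hanti : Antitone fun r => S.older (τ + r) ω 0 r + S.older (τ + r) ω 1 r :=
    antitone_nat_of_succ_le fun r => add_le_add (hstep r 0) (hstep r 1)
  -- Follow the users older than `r` in slot `τ + r`. Their mass never increases and ends above `α`,
  -- so it exceeds `α` throughout and all service goes to them. They lose at least `p 1 * α - 2 * ε`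
  -- per slot, too much over `n₀` slots.
  have key : ∀ r ≤ n₀, S.older (τ + r) ω 0 r + S.older (τ + r) ω 1 r ≤
      1 - r * (p 1 * α - 2 * ε) := by
    intro r
    induction r with
    | zero =>
      intro _
      rw [(A _ ω).g_zero, (A _ ω).g_zero, H.γ_sum]; simp
    | succ r ih =>
      intro hr
      have h1 := ih (by omega)
      have h2 := (A (τ + r) ω).rate_le (by omega) (hlast.trans_le (hanti (by omega : r ≤ n₀)))
      have h3 := fun k => hnoise.dyn H.p_pos (by omega : τ + r < T) k r
      have h4 := (abs_le.1 (h3 0)).2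
      have h5 := (abs_le.1 (h3 1)).2
      rw [min_eq_left (h2 0)] at h4
      rw [min_eq_left (h2 1)] at h5
      have h6 := (A (τ + r) ω).sum
      have h7 := mul_nonneg (sub_pos.2 H.lt).le (S.rate_nonneg (τ + r) ω 0)
      rw [← add_assoc]
      push_cast
      rw [← h6] at h1 ⊢
      nlinarith
  have := key n₀ le_rfl
  linarith

/-- The recent past of a system follows the fluid dynamics. -/
lemma approxFluid (R : S.IsRegular γ α) (H : Admissible p γ α n₀)
    (halt : ∀ n ≤ n₀, whittleIndex (p 0) n < whittleIndex (p 1) (n + 1)) {ω : Ω} {ε : ℝ} {T : ℕ}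
    (hnoise : S.NoiseLE ω ε T) (hε : 1 - α < n₀ * (p 1 * α - 2 * ε)) {t L : ℕ} (ht : n₀ + L ≤ t)
    (htT : t ≤ T) : ApproxFluid p γ α n₀ ε L
      (fun s => S.rate (t - s) ω, fun s => S.older (t - s) ω) where
  -- For `s > t` the truncated `t - s` repeats slot 0. This is harmless: the allocation relations
  -- hold in any slot, and the dynamics are required only for `s < L ≤ t`.
  alloc s := S.allocation R H halt _ ω
  top s hs k := older_le_rate R H halt hnoise hε (by omega) (by omega) k
  dyn s hs k n := by
    have := hnoise.dyn H.p_pos (t := t - (s + 1)) (by omega) k n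
    rwa [show t - (s + 1) + 1 = t - s by omega] at this

/-- Old ages have geometric tails. -/
lemma older_le_geometric (R : S.IsRegular γ α) (H : Admissible p γ α n₀)
    (halt : ∀ n ≤ n₀, whittleIndex (p 0) n < whittleIndex (p 1) (n + 1)) {ω : Ω} {ε : ℝ} {T : ℕ}
    (hnoise : S.NoiseLE ω ε T) (hε : 1 - α < n₀ * (p 1 * α - 2 * ε)) (hε0 : 0 ≤ ε) {I : ℕ}
    (hI : ∀ j, S.init ω j ≤ I) {t : ℕ} (htT : t ≤ T) (k : Fin 2) (n : ℕ) :
    S.older t ω k n ≤ ((1 - p 1) ^ (I + n₀))⁻¹ * (1 - p 1) ^ n + t * ε := by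
  have A := S.allocation R H halt
  have hr := sub_pos.2 (H.p_lt_one 1)
  have hr1 : 1 - p 1 ≤ 1 := by linarith [H.pos₁]
  have hγ : γ k ≤ 1 := by
    have h0 := H.γ_pos 0
    have h1 := H.γ_pos 1
    have h2 := H.γ_sum
    fin_cases k <;> simp <;> linarith
  have hyoung : ∀ t n, n ≤ I + n₀ →
      S.older t ω k n ≤ ((1 - p 1) ^ (I + n₀))⁻¹ * (1 - p 1) ^ n + t * ε := by
    intro t n hn
    have h1 : 1 ≤ ((1 - p 1) ^ (I + n₀))⁻¹ * (1 - p 1) ^ n := by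
      rw [← div_eq_inv_mul, one_le_div (pow_pos hr _)]
      exact pow_le_pow_of_le_one hr.le hr1 hn
    have h2 : 0 ≤ t * ε := by positivity
    have h3 := (A t ω).g_le k n
    linarith
  have hbound_nonneg : ∀ (t n : ℕ), 0 ≤ ((1 - p 1) ^ (I + n₀))⁻¹ * (1 - p 1) ^ n + t * ε :=
    fun t n => by positivity
  induction t generalizing n with
  | zero =>
    rcases le_or_gt n (I + n₀) with hn | hn
    · exact hyoung 0 n hn
    · rw [S.older_eq_zero hI (by omega)]
      exact hbound_nonneg 0 n
  | succ t ih =>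
    rcases le_or_gt n (I + n₀) with hn | hn
    · exact hyoung (t + 1) n hn
    -- During the first `n₀` slots no user can be older than `I + n₀`. Afterwards every user older
    -- than `n₀` is served, so these tails contract by at least `1 - p 1` per slot, up to `ε`.
    rcases lt_or_ge t n₀ with ht | ht
    · rw [S.older_eq_zero hI (by omega)]
      exact hbound_nonneg _ n
    · obtain ⟨m, rfl⟩ : ∃ m, n = m + 1 := ⟨n - 1, by omega⟩
      have h1 := (abs_le.1 (hnoise.dyn H.p_pos (by omega : t < T) k m)).2
      have h2 := older_le_rate R H halt hnoise hε ht (by omega) k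
      rw [min_eq_right ((S.older_antitone t ω k (by omega : n₀ ≤ m)).trans h2)] at h1
      have h3 := ih (by omega) m
      have h4 : p 1 ≤ p k := by fin_cases k <;> simp [H.lt.le]
      have h5 := mul_le_mul_of_nonneg_right h4 (S.older_nonneg t ω k m)
      have h6 := mul_le_mul_of_nonneg_left h3 hr.le
      have h7 : 0 ≤ p 1 * (t * ε) := mul_nonneg H.pos₁.le (by positivity)
      rw [pow_succ]
      push_cast
      linarith

end WhittleSystem

end WhittleAoI

namespace WhittleAoI

/-! ### Concentration of the numbers of successes -/

namespace WhittleSystem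

variable {p γ : Fin 2 → ℝ} {α : ℝ} {n₀ N M : ℕ} {Ω : Type*} [MeasurableSpace Ω] {P : Measure Ω}
  (S : WhittleSystem p N M P)

lemma measurable_chan (t : ℕ) : Measurable (S.chan t) := (S.chan_meas t).mono (S.ℱ.le _) le_rfl

/-- The indicator of a decoding success. -/
def success (t : ℕ) (j : Fin N) (ω : Ω) : ℝ := if S.chan t ω j = true then 1 else 0

lemma sum_success (t : ℕ) (ω : Ω) (b : Finset (Fin N)) :
    ∑ j ∈ b, S.success t j ω = (b.filter fun j => S.chan t ω j = true).card := by
  simp [success]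

lemma measurable_success (t : ℕ) (j : Fin N) : Measurable (S.success t j) :=
  (measurable_of_finite fun c : Bool => if c = true then (1 : ℝ) else 0).comp
    ((measurable_pi_apply j).comp (S.measurable_chan t))

lemma success_mem_Icc (t : ℕ) (j : Fin N) (ω : Ω) : S.success t j ω ∈ Set.Icc (0 : ℝ) 1 := by
  unfold success; split_ifs <;> simp

lemma integral_success (hp : ∀ k, 0 < p k) (t : ℕ) (j : Fin N) :
    ∫ ω, S.success t j ω ∂P = p (S.cls j) := by
  have hm : MeasurableSet {ω | S.chan t ω j = true} :=
    ((measurable_pi_apply j).comp (S.measurable_chan t)) (measurableSet_singleton true)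
  have e : S.success t j = {ω | S.chan t ω j = true}.indicator 1 := by
    ext ω; simp [success, Set.indicator]
  rw [e, integral_indicator_one hm, Measure.real, S.chan_law,
    ENNReal.toReal_ofReal (hp _).le]

lemma measurableSet_lt_age (t n : ℕ) (j : Fin N) : MeasurableSet[S.ℱ t] {ω | n < S.age t ω j} := by
  induction t generalizing n with
  | zero => exact S.init_meas ((Set.to_countable {s : Fin N → ℕ | n < s j}).measurableSet)
  | succ t ih =>
    have hs : MeasurableSet[S.ℱ (t + 1)] {ω | j ∈ S.sched t ω} :=
      S.ℱ.mono t.le_succ _ (S.sched_meas t j)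
    have hc : MeasurableSet[S.ℱ (t + 1)] {ω | S.chan t ω j = true} :=
      S.chan_meas t ((Set.toFinite {c : Fin N → Bool | c j = true}).measurableSet)
    cases n with
    | zero =>
      have : {ω | 0 < S.age (t + 1) ω j} = Set.univ :=
        Set.eq_univ_of_forall fun ω => S.one_le_age (t + 1) ω j
      rw [this]
      exact MeasurableSet.univ
    | succ n =>
      have : {ω | n + 1 < S.age (t + 1) ω j} = {ω | n < S.age t ω j} \
          ({ω | j ∈ S.sched t ω} ∩ {ω | S.chan t ω j = true}) := by
        ext ω
        simp only [Set.mem_ofPred_eq, Set.mem_sdiff, Set.mem_inter_iff, S.age_succ]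
        split_ifs with h <;> simp [h]
      rw [this]
      exact (S.ℱ.mono t.le_succ _ (ih n)).diff (hs.inter hc)

lemma measurableSet_schedOlder (t : ℕ) (k : Fin 2) (n : ℕ) (b : Finset (Fin N)) :
    MeasurableSet[S.ℱ t] {ω | S.schedOlder t ω k n = b} := by
  have h : ∀ j, MeasurableSet[S.ℱ t] {ω | j ∈ S.schedOlder t ω k n} := by
    intro j
    have : {ω | j ∈ S.schedOlder t ω k n} =
        {ω | j ∈ S.sched t ω} ∩ ({_ω | S.cls j = k} ∩ {ω | n < S.age t ω j}) := by
      ext ω; simp [schedOlder]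
    rw [this]
    exact (S.sched_meas t j).inter ((MeasurableSet.const _).inter (S.measurableSet_lt_age t n j))
  have e : {ω | S.schedOlder t ω k n = b} = ⋂ j, {ω | j ∈ S.schedOlder t ω k n ↔ j ∈ b} := by
    ext ω; simp [Finset.ext_iff]
  rw [e]
  refine MeasurableSet.iInter fun j => ?_
  by_cases hj : j ∈ b
  · simpa [hj] using h j
  · simp only [hj, iff_false]
    exact (h j).compl

lemma measurableSet_Z_zero (x : Fin 2 → ℕ → ℝ) : MeasurableSet[S.ℱ 0] {ω | S.Z 0 ω = x} :=
  S.init_meas ((Set.to_countable {s : Fin N → ℕ | (fun (k : Fin 2) (i : ℕ) =>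
    ((Finset.univ.filter fun j : Fin N => S.cls j = k ∧ s j = i).card : ℝ) / N) = x}).measurableSet)

lemma init_le_of_Z_eq {x : Fin 2 → ℕ → ℝ} {I : ℕ} (hx : ∀ k, ∀ i > I, x k i = 0) {ω : Ω}
    (hω : S.Z 0 ω = x) (j : Fin N) : S.init ω j ≤ I := by
  by_contra! h
  have h1 : S.Z 0 ω (S.cls j) (S.init ω j) = 0 := by rw [hω]; exact hx _ _ h
  have hN : (N : ℝ) ≠ 0 := by
    have := j.pos
    exact_mod_cast this.ne'
  rw [Z, div_eq_zero_iff, or_iff_left hN, Nat.cast_eq_zero, Finset.card_eq_zero,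
    Finset.filter_eq_empty_iff] at h1
  exact h1 (Finset.mem_univ j) ⟨rfl, rfl⟩

variable [IsProbabilityMeasure P]

lemma memLp_success (t : ℕ) (j : Fin N) : MemLp (S.success t j) 2 P :=
  memLp_of_bounded (Filter.Eventually.of_forall (S.success_mem_Icc t j))
    (S.measurable_success t j).aestronglyMeasurable 2

/-- Chebyshev's inequality for the number of successes in a deterministic set of users. -/
lemma measure_deviation_le (hp : ∀ k, 0 < p k) (hN : 0 < N) (t : ℕ) (k : Fin 2)
    {b : Finset (Fin N)} (hb : ∀ j ∈ b, S.cls j = k) {ε : ℝ} (hε : 0 < ε) :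
    P {ω | ε < |((b.filter fun j => S.chan t ω j = true).card : ℝ) / N -
      p k * ((b.card : ℝ) / N)|} ≤ ENNReal.ofReal (1 / ε ^ 2 / N) := by
  have hN' : (0 : ℝ) < N := by exact_mod_cast hN
  have hmem : MemLp (∑ j ∈ b, S.success t j) 2 P :=
    memLp_finsetSum' _ fun j _ => S.memLp_success t j
  have hint : ∫ ω, (∑ j ∈ b, S.success t j) ω ∂P = p k * b.card := by
    simp only [Finset.sum_apply]
    rw [integral_finsetSum _ fun j _ => (S.memLp_success t j).integrable one_le_two,
      Finset.sum_congr rfl fun j hj => by rw [S.integral_success hp, hb j hj]]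
    simp [mul_comm]
  have hvar : variance (∑ j ∈ b, S.success t j) P ≤ N := by
    rw [IndepFun.variance_sum (fun j _ => S.memLp_success t j) fun i _ j _ hij =>
      ((S.chan_indep t).indepFun hij).comp (φ := fun c : Bool => if c = true then (1 : ℝ) else 0)
        (ψ := fun c : Bool => if c = true then (1 : ℝ) else 0) (measurable_of_finite _)
        (measurable_of_finite _)]
    calc ∑ j ∈ b, variance (S.success t j) P ≤ ∑ _j ∈ b, (1 : ℝ) := by
          refine Finset.sum_le_sum fun j _ => ?_
          refine (variance_le_sq_of_bounded (Filter.Eventually.of_forall (S.success_mem_Icc t j))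
            (S.measurable_success t j).aemeasurable).trans ?_
          norm_num
      _ = b.card := by simp
      _ ≤ N := by exact_mod_cast b.card_le_univ.trans_eq (Fintype.card_fin N)
  refine (measure_mono fun ω hω => ?_).trans
    ((meas_ge_le_variance_div_sq hmem (mul_pos hε hN')).trans (ENNReal.ofReal_le_ofReal ?_))
  · rw [Set.mem_ofPred_eq] at hω ⊢
    rw [hint, Finset.sum_apply, S.sum_success]
    rw [← mul_div_assoc, ← sub_div, abs_div, abs_of_pos hN', lt_div_iff₀ hN'] at hω
    exact hω.le
  · calc variance (∑ j ∈ b, S.success t j) P / (ε * N) ^ 2 ≤ N / (ε * N) ^ 2 := by gcongr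
      _ = 1 / ε ^ 2 / N := by field_simp

/-- Chebyshev's inequality for the number of successes in a set of users that depends on the
past, on an event of the past. -/
lemma measure_inter_deviation_le (hp : ∀ k, 0 < p k) (hN : 0 < N) (t : ℕ) (k : Fin 2)
    {B : Ω → Finset (Fin N)} (hB : ∀ ω, ∀ j ∈ B ω, S.cls j = k)
    (hBm : ∀ b, MeasurableSet[S.ℱ t] {ω | B ω = b}) {E : Set Ω} (hE : MeasurableSet[S.ℱ t] E)
    {ε : ℝ} (hε : 0 < ε) :
    P (E ∩ {ω | ε < |(((B ω).filter fun j => S.chan t ω j = true).card : ℝ) / N -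
      p k * (((B ω).card : ℝ) / N)|}) ≤ P E * ENNReal.ofReal (1 / ε ^ 2 / N) := by
  set D : Finset (Fin N) → Set Ω := fun b =>
    {ω | ε < |((b.filter fun j => S.chan t ω j = true).card : ℝ) / N -
      p k * ((b.card : ℝ) / N)|} with hD
  have hDm : ∀ b, MeasurableSet[MeasurableSpace.comap (S.chan t) inferInstance] (D b) := fun b =>
    ⟨{c | ε < |((b.filter fun j => c j = true).card : ℝ) / N - p k * ((b.card : ℝ) / N)|},
      (Set.toFinite _).measurableSet, rfl⟩
  have hEB : ∀ b, MeasurableSet[S.ℱ t] (E ∩ {ω | B ω = b}) := fun b => hE.inter (hBm b)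
  have hstep : ∀ b, P (D b ∩ (E ∩ {ω | B ω = b})) ≤
      P (E ∩ {ω | B ω = b}) * ENNReal.ofReal (1 / ε ^ 2 / N) := by
    -- On `B = b` the random set is frozen; the deviation for `b` depends only on the current
    -- channel states, which are independent of the past event.
    intro b
    by_cases hb : ∀ j ∈ b, S.cls j = k
    · rw [(Indep_iff _ _ _).1 (S.chan_indep_past t) _ _ (hDm b) (hEB b), mul_comm]
      gcongr
      exact S.measure_deviation_le hp hN t k hb hε
    · have : E ∩ {ω | B ω = b} = ∅ := by
        refine Set.eq_empty_of_forall_notMem fun ω hω => hb ?_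
        rw [← show B ω = b from hω.2]
        exact hB ω
      rw [this]; simp
  calc P (E ∩ {ω | ε < |(((B ω).filter fun j => S.chan t ω j = true).card : ℝ) / N -
          p k * (((B ω).card : ℝ) / N)|})
      ≤ P (⋃ b, D b ∩ (E ∩ {ω | B ω = b})) := by
        refine measure_mono fun ω hω => Set.mem_iUnion.2 ⟨B ω, hω.2, hω.1, rfl⟩
    _ ≤ ∑ b, P (D b ∩ (E ∩ {ω | B ω = b})) := measure_iUnion_fintype_le _ _
    _ ≤ ∑ b, P (E ∩ {ω | B ω = b}) * ENNReal.ofReal (1 / ε ^ 2 / N) :=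
        Finset.sum_le_sum fun b _ => hstep b
    _ = P E * ENNReal.ofReal (1 / ε ^ 2 / N) := by
        rw [← Finset.sum_mul]
        congr 1
        rw [← tsum_fintype (L := .unconditional _), ← measure_iUnion]
        · congr 1
          ext ω; simp
        · intro b b' h
          refine Set.disjoint_left.2 fun ω hω hω' => h ?_
          exact hω.2.symm.trans hω'.2
        · exact fun b => S.ℱ.le t _ (hEB b)

/-- Conditionally on the initial state, the numbers of successes are uniformly close to their means
except with probability `O(1 / N)`. -/
lemma cond_not_noiseLE_le (hp : ∀ k, 0 < p k) (hN : 0 < N) {x : Fin 2 → ℕ → ℝ} {I : ℕ}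
    (hx : ∀ k, ∀ i > I, x k i = 0) {ε : ℝ} (hε : 0 < ε) (T : ℕ) :
    (cond P {ω | S.Z 0 ω = x}) {ω | S.Z 0 ω = x ∧ ¬ S.NoiseLE ω ε T} ≤
      ENNReal.ofReal ((T * 2 * (I + T) : ℕ) * (1 / ε ^ 2) / N) := by
  set E := {ω | S.Z 0 ω = x} with hE
  set D : ℕ → Fin 2 → ℕ → Set Ω := fun t k n => {ω | ε <
    |(((S.schedOlder t ω k n).filter fun j => S.chan t ω j = true).card : ℝ) / N -
      p k * (((S.schedOlder t ω k n).card : ℝ) / N)|} with hD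
  have hsub : E ∩ {ω | S.Z 0 ω = x ∧ ¬ S.NoiseLE ω ε T} ⊆
      ⋃ i ∈ Finset.range T ×ˢ (Finset.univ : Finset (Fin 2)) ×ˢ Finset.range (I + T),
        E ∩ D i.1 i.2.1 i.2.2 := by
    rintro ω ⟨hω, -, hn⟩
    unfold NoiseLE at hn
    push Not at hn
    obtain ⟨t, ht, k, n, h⟩ := hn
    -- No user reaches an age above `I + T` before slot `T`, so larger `n` give empty sets without
    -- deviation: the union bound is finite and its size does not depend on `N`.
    have hnI : n < I + T := by
      by_contra! hnI
      have : S.schedOlder t ω k n = ∅ := by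
        refine Finset.filter_false_of_mem fun j _ hj => ?_
        have := S.age_le (S.init_le_of_Z_eq hx hω) t j
        omega
      rw [this] at h
      simp at h
      linarith
    refine Set.mem_iUnion₂.2 ⟨(t, k, n), ?_, hω, h⟩
    simp [ht, hnI]
  have hterm : ∀ t k n, P (E ∩ D t k n) ≤ P E * ENNReal.ofReal (1 / ε ^ 2 / N) := fun t k n =>
    S.measure_inter_deviation_le hp hN t k (fun ω j hj => (Finset.mem_filter.1 hj).2.1)
      (S.measurableSet_schedOlder t k n) (S.ℱ.mono (Nat.zero_le t) _ (S.measurableSet_Z_zero x)) hε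
  have hP : P (E ∩ {ω | S.Z 0 ω = x ∧ ¬ S.NoiseLE ω ε T}) ≤
      P E * ENNReal.ofReal ((T * 2 * (I + T) : ℕ) * (1 / ε ^ 2) / N) := by
    calc _ ≤ _ := measure_mono hsub
      _ ≤ ∑ i ∈ Finset.range T ×ˢ (Finset.univ : Finset (Fin 2)) ×ˢ Finset.range (I + T),
          P (E ∩ D i.1 i.2.1 i.2.2) := measure_biUnion_finset_le _ _
      _ ≤ ∑ i ∈ Finset.range T ×ˢ (Finset.univ : Finset (Fin 2)) ×ˢ Finset.range (I + T),
          P E * ENNReal.ofReal (1 / ε ^ 2 / N) := Finset.sum_le_sum fun i _ => hterm _ _ _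
      _ = _ := by
          rw [Finset.sum_const, Finset.card_product, Finset.card_product, Finset.card_range,
            Finset.card_range, Finset.card_univ, Fintype.card_fin, nsmul_eq_mul, mul_left_comm,
            ← ENNReal.ofReal_natCast, ← ENNReal.ofReal_mul (Nat.cast_nonneg _), ← mul_assoc T 2,
            mul_div_assoc]
  rw [cond_apply (S.ℱ.le 0 _ (S.measurableSet_Z_zero x))]
  calc _ ≤ (P E)⁻¹ * (P E * ENNReal.ofReal ((T * 2 * (I + T) : ℕ) * (1 / ε ^ 2) / N)) := by gcongr
    _ ≤ _ := by
        rw [← mul_assoc]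
        exact mul_le_of_le_one_left' (ENNReal.inv_mul_le_one _)

end WhittleSystem

end WhittleAoI

namespace WhittleAoI

/-! ### Assembly -/

variable {p γ : Fin 2 → ℝ} {α : ℝ} {n₀ : ℕ}

lemma mixtureTail_le_geometric {p r γ θ : ℝ} {n : ℕ} (hp : 0 < p) (hp1 : p < 1) (hr : 1 - p ≤ r)
    (hr1 : r < 1) (hγ : 0 ≤ γ) (hγ1 : γ ≤ 1) (hθ : 0 ≤ θ) (hθ1 : θ ≤ 1) (hn : 1 ≤ n) (j : ℕ) :
    mixtureTail p γ θ n j ≤ (r ^ n)⁻¹ * r ^ j := by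
  have hr0 : 0 < r := by linarith
  have hle : ∀ j, mixtureTail p γ θ n j ≤ 1 := fun j =>
    ((mixtureTail_antitone hp hp1 hγ hθ hθ1 (Nat.zero_le j)).trans_eq (by simp [mixtureTail])).trans
      hγ1
  rcases le_total j n with h | h
  · refine (hle j).trans ?_
    rw [← div_eq_inv_mul, one_le_div (pow_pos hr0 _)]
    exact pow_le_pow_of_le_one hr0.le hr1.le h
  · obtain ⟨s, rfl⟩ := Nat.exists_eq_add_of_le h
    rw [mixtureTail_add hp hp1 hn, pow_add, inv_mul_cancel_left₀ (pow_pos hr0 n).ne']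
    have := pow_le_pow_left₀ (sub_nonneg.2 hp1.le) hr s
    calc (1 - p) ^ s * mixtureTail p γ θ n n ≤ r ^ s * 1 :=
          mul_le_mul this (hle n) (mixtureTail_nonneg hp hp1 hγ hθ hθ1 hn n) (by positivity)
      _ = r ^ s := mul_one _

/-- For every finite time window, a system in which the numbers of successes are close enough to
their means stays close to the relaxed optimum, after a time that does not depend on the window. -/
theorem exists_weightedNorm_sub_le (H : Admissible p γ α n₀)
    (halt : ∀ n ≤ n₀, whittleIndex (p 0) n < whittleIndex (p 1) (n + 1)) {θ : Fin 2 → ℝ} {n : ℕ}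
    (hn : 1 ≤ n) (hn₀ : n ≤ n₀) (hθ : ∀ k, 0 ≤ θ k) (hθ1 : ∀ k, θ k ≤ 1)
    (hpair : θ 0 = 0 ∨ θ 1 = 1)
    (hsum : mixtureRate (p 0) (γ 0) (θ 0) n + mixtureRate (p 1) (γ 1) (θ 1) n = α)
    (I : ℕ) {μ : ℝ} (hμ : 0 < μ) :
    ∃ T₀ : ℕ, ∀ T : ℕ, ∃ ε : ℝ, 0 < ε ∧
      ∀ {N M : ℕ} {Ω : Type*} [MeasurableSpace Ω] {P : Measure Ω} (S : WhittleSystem p N M P)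
        (ω : Ω), S.IsRegular γ α → (∀ j, S.init ω j ≤ I) → S.NoiseLE ω ε T →
        ∀ t, T₀ ≤ t → t ≤ T →
          weightedNorm (fun k i => S.Z t ω k i - mixture (p k) (γ k) (θ k) n i) ≤
            ENNReal.ofReal μ := by
  set r := 1 - p 1 with hr_def
  have hr : 0 < r := sub_pos.2 (H.p_lt_one 1)
  have hr1 : r < 1 := by have := H.pos₁; linarith
  set C := ((r ^ (I + n₀))⁻¹ + (r ^ n)⁻¹) * r⁻¹ with hC_def
  have hC : 0 ≤ C := by positivity
  obtain ⟨K, δ, hδ, hnorm⟩ := exists_weightedNorm_le hC hr hr1 hμ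
  have F := fluid_mixture H hn hn₀ hθ hθ1 hpair hsum
  obtain ⟨L, hL⟩ := exists_approxFluid_close F H (half_pos hδ) K
  have hn₀pos : (0 : ℝ) < n₀ := by exact_mod_cast hn.trans hn₀
  -- A quarter of the slack in `H.arrivals`, per slot: the loss `2 * ε * n₀` then consumes at most
  -- half of the slack.
  set ε₀ := (n₀ * p 1 * α - (1 - α)) / (4 * n₀) with hε₀_def
  have hgap := sub_pos.2 H.arrivals
  have hε₀ : 0 < ε₀ := div_pos hgap (by positivity)
  have hε₀' : ε₀ * (4 * n₀) = n₀ * p 1 * α - (1 - α) := div_mul_cancel₀ _ (by positivity)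
  -- `n₀` slots until all users older than `n₀` are served, then `L` slots of approximate fluid
  -- dynamics.
  refine ⟨n₀ + L, fun T => ?_⟩
  obtain ⟨η, hη, hnorm⟩ := hnorm (I + T)
  refine ⟨min ε₀ (min (1 / (L + 1)) (η / (T + 1))), lt_min hε₀ (lt_min (by positivity)
    (by positivity)), ?_⟩
  set ε := min ε₀ (min (1 / ((L : ℝ) + 1)) (η / (T + 1))) with hε_def
  have hεpos : 0 < ε := lt_min hε₀ (lt_min (by positivity) (by positivity))
  have h1 : ε ≤ ε₀ := min_le_left _ _
  have h2 : ε ≤ 1 / ((L : ℝ) + 1) := (min_le_right _ _).trans (min_le_left _ _)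
  have h3 : T * ε ≤ η := by
    have h : ε ≤ η / (T + 1) := (min_le_right _ _).trans (min_le_right _ _)
    rw [le_div_iff₀ (by positivity)] at h
    linarith
  have hε : 1 - α < n₀ * (p 1 * α - 2 * ε) := by
    have := mul_le_mul_of_nonneg_right h1 hn₀pos.le
    linarith
  intro N M Ω _ P S ω R hI hnoise t ht htT
  have hclose := hL _ ((WhittleSystem.approxFluid R H halt hnoise hε ht htT).mono h2 le_rfl)
  simp only [Nat.sub_zero] at hclose
  have hz0 : ∀ k, mixture (p k) (γ k) (θ k) n 0 = 0 := fun k => by simp [mixture, statDist]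
  have hz : ∀ k j, mixture (p k) (γ k) (θ k) n (j + 1) =
      mixtureTail (p k) (γ k) (θ k) n j - mixtureTail (p k) (γ k) (θ k) n (j + 1) := fun k j => by
    rw [mixtureTail_succ]; ring
  refine hnorm _ (fun k i hi => ?_) (fun k i => ?_)
  · rcases i with _ | j
    · simp [S.Z_zero, hz0, hδ.le]
    · have e1 := hclose k j (by omega)
      have e2 := hclose k (j + 1) hi
      rw [S.Z_succ, hz]
      rw [abs_lt] at e1 e2
      rw [abs_le]
      constructor <;> linarith [e1.1, e1.2, e2.1, e2.2]
  · rcases i with _ | j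
    · simp only [S.Z_zero, hz0, sub_zero, abs_zero]
      have : 0 ≤ C * r ^ 0 := by positivity
      split_ifs <;> linarith
    · have hpk : p 1 ≤ p k := by fin_cases k <;> simp [H.lt.le]
      have hγ : γ k ≤ 1 := by
        have h0 := H.γ_pos 0
        have h1 := H.γ_pos 1
        have h2 := H.γ_sum
        fin_cases k <;> simp <;> linarith
      have e1 : S.Z t ω k (j + 1) ≤
          (r ^ (I + n₀))⁻¹ * r ^ j + if j + 1 ≤ I + T then η else 0 := by
        rw [S.Z_succ]
        split_ifs with hj
        · have f1 := WhittleSystem.older_le_geometric R H halt hnoise hε hεpos.le hI htT k j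
          have f2 := S.older_nonneg t ω k (j + 1)
          have f3 : (t : ℝ) * ε ≤ T * ε := by gcongr
          linarith
        · rw [S.older_eq_zero hI (by omega), S.older_eq_zero hI (by omega), sub_self, add_zero]
          positivity
      have e2 : mixture (p k) (γ k) (θ k) n (j + 1) ≤ (r ^ n)⁻¹ * r ^ j := by
        have f1 := mixtureTail_le_geometric (H.p_pos k) (H.p_lt_one k) (by linarith : 1 - p k ≤ r)
          hr1 (H.γ_pos k).le hγ (hθ k) (hθ1 k) hn j
        have f2 := mixtureTail_nonneg (H.p_pos k) (H.p_lt_one k) (H.γ_pos k).le (hθ k) (hθ1 k) hn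
          (j + 1)
        rw [hz]
        linarith
      have e3 := mixture_nonneg (n := n) (H.p_pos k) (H.p_lt_one k) (H.γ_pos k).le (hθ k) (hθ1 k)
        (j + 1)
      have e4 : 0 ≤ S.Z t ω k (j + 1) := by unfold WhittleSystem.Z; positivity
      have e5 : C * r ^ (j + 1) = (r ^ (I + n₀))⁻¹ * r ^ j + (r ^ n)⁻¹ * r ^ j := by
        rw [hC_def, pow_succ]
        field_simp
      rw [e5]
      have e6 : 0 ≤ (r ^ (I + n₀))⁻¹ * r ^ j := by positivity
      have e7 : 0 ≤ (r ^ n)⁻¹ * r ^ j := by positivity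
      have e8 : (0 : ℝ) ≤ if j + 1 ≤ I + T then η else 0 := by split_ifs <;> linarith
      rw [abs_le]
      constructor <;> linarith

end WhittleAoI

theorem mainTheorem5
    (p γ : Fin 2 → ℝ) (α : ℝ)
    (hp₂ : 0 < p 1) (hp : p 1 < p 0) (hp₁ : p 0 < 1)
    (hγ : ∀ k, 0 < γ k) (hγ_sum : γ 0 + γ 1 = 1)
    (hα : 1 / (1 + (WhittleAoI.alternationBound (p 0) (p 1) - 2) * p 1) < α) (hα₁ : α < 1) :
    ∃ zstar : Fin 2 → ℕ → ℝ,
      (∀ z, WhittleAoI.IsRelaxedOptimum p γ α z ↔ z = zstar) ∧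
      ∀ (x : Fin 2 → ℕ → ℝ) (μ : ℝ), 0 < μ →
        ∃ T₀ : ℕ, ∀ T : ℕ, T₀ < T →
          ∃ s : ℝ, 0 < s ∧
            ∀ (N M : ℕ) (Ω : Type*) [MeasurableSpace Ω] (P : Measure Ω) [IsProbabilityMeasure P]
              (S : WhittleAoI.WhittleSystem p N M P),
              0 < N → (M : ℝ) = α * N →
              (∀ k, ((Finset.univ.filter fun j : Fin N => S.cls j = k).card : ℝ) = γ k * N) →
              (γ 0 / (1 + p 0) + γ 1 / (1 + p 1) < α → S.FirstClassFirstAtAgeOne) →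
              (ProbabilityTheory.cond P {ω | S.Z 0 ω = x})
                  {ω | ENNReal.ofReal μ ≤ ⨆ t ∈ Set.Ico T₀ T,
                    WhittleAoI.weightedNorm (fun k i => S.Z t ω k i - zstar k i)} ≤
                ENNReal.ofReal (s / N) := by
  obtain ⟨n₀, H, halt⟩ := WhittleAoI.exists_admissible hp₂ hp hp₁ hγ hγ_sum hα hα₁
  obtain ⟨θ, n, hn, hn₀, hθ, hθ1, hpair, hsum, hopt⟩ := WhittleAoI.exists_isRelaxedOptimum H halt
  refine ⟨_, fun z => ⟨fun hz => hz.unique H.p_pos H.p_lt_one hγ hopt, fun hz => hz ▸ hopt⟩,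
    fun x μ hμ => ?_⟩
  by_cases hx : ∃ I, ∀ k, ∀ i > I, x k i = 0
  · obtain ⟨I, hI⟩ := hx
    -- Half of `μ`, because the deterministic bound is not strict while the bad event is that the
    -- supremum is at least `μ`.
    obtain ⟨T₀, hT₀⟩ := WhittleAoI.exists_weightedNorm_sub_le H halt hn hn₀ hθ hθ1 hpair hsum I
      (half_pos hμ)
    refine ⟨T₀, fun T _ => ?_⟩
    obtain ⟨ε, hε, hdet⟩ := hT₀ T
    refine ⟨(T * 2 * (I + T) : ℕ) * (1 / ε ^ 2) + 1, by positivity, ?_⟩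
    intro N M Ω _ P _ S hN hM hcls hfirst
    have R : S.IsRegular γ α := ⟨hN, hM, hcls, hfirst⟩
    rw [← ProbabilityTheory.cond_inter_self (S.ℱ.le 0 _ (S.measurableSet_Z_zero x))]
    refine (MeasureTheory.measure_mono ?_).trans
      ((S.cond_not_noiseLE_le H.p_pos hN hI hε T).trans (ENNReal.ofReal_le_ofReal ?_))
    · rintro ω ⟨hω, hbad⟩
      refine ⟨hω, fun hnoise => ?_⟩
      have hle : ⨆ t ∈ Set.Ico T₀ T, WhittleAoI.weightedNorm (fun k i => S.Z t ω k i -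
          WhittleAoI.mixture (p k) (γ k) (θ k) n i) ≤ ENNReal.ofReal (μ / 2) :=
        iSup₂_le fun t ht => hdet S ω R (S.init_le_of_Z_eq hI hω) hnoise t ht.1 ht.2.le
      exact absurd (le_trans hbad hle)
        (not_le.2 ((ENNReal.ofReal_lt_ofReal_iff hμ).2 (half_lt_self hμ)))
    · gcongr
      linarith
  -- A vector without finite support is not the initial state of any finite system. The conditioning
  -- event is then empty, and conditioning on it gives the zero measure.
  · refine ⟨0, fun T _ => ⟨1, one_pos, ?_⟩⟩
    intro N M Ω _ P _ S hN _ _ _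
    have hempty : {ω | S.Z 0 ω = x} = ∅ := by
      refine Set.eq_empty_of_forall_notMem fun ω hω => hx ?_
      refine ⟨∑ j, S.init ω j, fun k i hi => ?_⟩
      rw [← show S.Z 0 ω = x from hω, WhittleAoI.WhittleSystem.Z, Finset.filter_false_of_mem]
      · simp
      · rintro j - ⟨-, hj⟩
        have := Finset.single_le_sum (f := S.init ω) (fun _ _ => Nat.zero_le _) (Finset.mem_univ j)
        rw [S.age_zero] at hj
        omega
    rw [hempty, ProbabilityTheory.cond_empty]
    simp
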